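/- Let $\mathcal S,\mathcal A,\mathcal D$ be finite sets of states, actions and agents. In an episode of length $L$ with initial condition $(s_1,d_0)\in\mathcal S\times\mathcal D$, at each time $t=1,\dots,L$ a deterministic time-varying switching policy $\pi$ gives control to agent $d_t=\pi_t(s_t,d_{t-1})$, the agent draws an action $a_t\sim p_{d_t}(\cdot\mid s_t)$, and the environment draws $s_{t+1}\sim p(\cdot\mid s_t,a_t)$. The agents' policies $p_d$ and the transition probabilities $p$ are unknown. The cost of the trajectory $\tau$ is $$c(\tau\mid s_1,d_0)=\sum_{t=1}^L c'(s_t,a_t)+c_c(d_t)+c_x(d_t,d_{t-1}),$$ with known costs such that $0\le c'(s,a)+c_c(d)+c_x(d,d')\le 1$ for all $s,a,d,d'$. Let $0<\delta<1$. Algorithm UCRL2-MC runs for $K$ episodes of length $L$; put $T=KL$. Let $N_k(s,d)$, $N_k(s,d,a)$, $N'_k(s,a)$, $N'_k(s,a,s')$ be the numbers of steps, in all episodes before episode $k$, with $(s_t,d_t)=(s,d)$, with $(s_t,d_t,a_t)=(s,d,a)$, with $(s_t,a_t)=(s,a)$, and with $(s_t,a_t,s_{t+1})=(s,a,s')$.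 Let $\hat p^k_d(a\mid s)=N_k(s,d,a)/N_k(s,d)$ (or $1/|\mathcal A|$ if $N_k(s,d)=0$) and $\hat p^k(s'\mid s,a)=N'_k(s,a,s')/N'_k(s,a)$ (or $1/|\mathcal S|$ if $N'_k(s,a)=0$). For $k\ge 2$ let $\mathcal P^k_{\cdot\mid d,s}$ be the set of probability distributions on $\mathcal A$ with $L^1$-distance at most $\beta^k_{\mathcal D}(s,d)$ from $\hat p^k_d(\cdot\mid s)$, and let $\mathcal P^k_{\cdot\mid s,a}$ be the set of probability distributions on $\mathcal S$ with $L^1$-distance at most $\beta^k(s,a)$ from $\hat p^k(\cdot\mid s,a)$, where $$\beta^k_{\mathcal D}(s,d)=\sqrt{\frac{2\log\left((k-1)^7L^7|\mathcal S||\mathcal D|2^{|\mathcal A|+1}/\delta\right)}{\max\{1,N_k(s,d)\}}},\qquad \beta^k(s,a)=\sqrt{\frac{2\log\left((k-1)^7L^7|\mathcal S||\mathcal A|2^{|\mathcal S|+1}/\delta\right)}{\max\{1,N'_k(s,a)\}}}.$$ Put $v^k_{L+1}=0$ and, for $t=L,\dots,1$, $$v^k_t(s,d)=\min_{d'\in\mathcal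 D}\Big[c_c(d')+c_x(d',d)+\min_{q\in\mathcal P^k_{\cdot\mid d',s}}\sum_{a}q(a)\Big(c'(s,a)+\min_{r\in\mathcal P^k_{\cdot\mid s,a}}\sum_{s'}r(s')\,v^k_{t+1}(s',d')\Big)\Big].$$ In episode $k\ge2$ the algorithm deploys a policy $\pi^k$ for which $\pi^k_t(s,d)$ is a minimizer $d'$ of this expression for all $t,s,d$; in the first episode, where there are no data, it deploys an arbitrary policy. The initial condition $(s_1,d_0)$ of each episode may be fixed, or drawn from any law that may depend on the data of the previous episodes. The total regret is $$R(T)=\sum_{k=1}^K\Big(\mathbb E_{\tau\sim\pi^k}\big[c(\tau\mid s_1,d_0)\big]-\min_\pi\mathbb E_{\tau\sim\pi}\big[c(\tau\mid s_1,d_0)\big]\Big),$$ where the expectations are under the true agents' policies and transition probabilities, for the deployed $\pi^k$ and the initial condition $(s_1,d_0)$ of episode $k$. Then there are absolute constants $\rho_1,\rho_2>0$ such that, for all such data and every $K$, with probability at least $1-\delta$, $$R(T)\le\rho_1L\sqrt{|\mathcal A||\mathcal S||\mathcal D|\,T\log\left(\frac{|\mathcal S||\mathcal D|T}{\delta}\right)}+\rho_2L|\mathcal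 S|\sqrt{|\mathcal A|\,T\log\left(\frac{|\mathcal S||\mathcal A|T}{\delta}\right)}.$$ For a fixed problem (with $L$ and $\delta$ fixed), the right-hand side is $o(T)$ as $K\to\infty$. -/

import Mathlib

universe u v w

namespace SwitchMDP

noncomputable section

/-- The known costs: `env s a = c'(s, a)`, `ctrl d = c_c(d)`, and
`switch d d' = c_x(d, d')`, the cost of switching from `d'` to `d`. -/
structure Costs (S : Type u) (A : Type v) (D : Type w) where
  env : S → A → ℝ
  ctrl : D → ℝ
  switch : D → D → ℝ

/-- The unknown true dynamics: `agent d s` is the law `p_d(· | s)` of the action of agent `d` in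
state `s`, and `trans s a` is the law `p(· | s, a)` of the next state. -/
structure Dynamics (S : Type u) (A : Type v) (D : Type w) where
  agent : D → S → PMF A
  trans : S → A → PMF S

/-- One observed time step `(s_t, d_t, a_t, s_{t+1})`. -/
abbrev Step (S : Type u) (A : Type v) (D : Type w) := S × D × A × S

/-- A trajectory of `n` time steps. -/
abbrev Traj (S : Type u) (A : Type v) (D : Type w) (n : ℕ) := Fin n → Step S A D

/-- A deterministic time-varying switching policy with horizon `n`: `π t s d` is the agent which
gets control at time `t` in state `s` if `d` had control before. Times are counted from `0`. -/
abbrev Policy (S : Type u) (D : Type w) (n : ℕ) := Fin n → S → D → D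

/-- The data of one episode: the initial condition `(s_1, d_0)` and the trajectory. -/
abbrev Episode (S : Type u) (A : Type v) (D : Type w) (L : ℕ) := (S × D) × Traj S A D L

/-- The data of `j` completed episodes. -/
abbrev History (S : Type u) (A : Type v) (D : Type w) (L j : ℕ) := Fin j → Episode S A D L

variable {S : Type u} {A : Type v} {D : Type w}

/-- The law of the trajectory of `n` steps when `π` is deployed from `(s, d)`: at each step the
switching policy picks the agent, the agent draws an action and the environment draws the
next state. -/
def rollout (M : Dynamics S A D) : {n : ℕ} → Policy S D n → S → D → PMF (Traj S A D n)
  | 0, _, _, _ => PMF.pure Fin.elim0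
  | n + 1, π, s, d =>
      (M.agent (π 0 s d) s).bind fun a =>
        (M.trans s a).bind fun s' =>
          (rollout M (n := n) (Fin.tail π) s' (π 0 s d)).map fun τ =>
            (Fin.cons (s, π 0 s d, a, s') τ : Traj S A D (n + 1))

/-- The total cost `c(τ | s_1, d_0) = ∑_t c'(s_t, a_t) + c_c(d_t) + c_x(d_t, d_{t-1})`. In the
sequence `d_0, d_1, …, d_n`, the entry with index `t.castSucc` is the agent before step `t`. -/
def trajCost (c : Costs S A D) {n : ℕ} (d₀ : D) (τ : Traj S A D n) : ℝ :=
  ∑ t : Fin n, (c.env (τ t).1 (τ t).2.2.1 + c.ctrl (τ t).2.1 +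
    c.switch (τ t).2.1 ((Fin.cons d₀ fun i => (τ i).2.1 : Fin (n + 1) → D) t.castSucc))

/-- The expected cost of `π` from the initial condition `(s, d)` under the true dynamics. -/
def expCost [Fintype S] [Fintype A] [Fintype D] (c : Costs S A D) (M : Dynamics S A D) {n : ℕ}
    (π : Policy S D n) (s : S) (d : D) : ℝ :=
  ∑ τ : Traj S A D n, (rollout M π s d τ).toReal * trajCost c d τ

/-- The expected cost of an optimal switching policy (a minimum over finitely many policies). -/
def optCost [Fintype S] [Fintype A] [Fintype D] (c : Costs S A D) (M : Dynamics S A D) (n : ℕ)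
    (s : S) (d : D) : ℝ :=
  ⨅ π : Policy S D n, expCost c M π s d

section Learning

variable [Fintype S] [Fintype A] [Fintype D] [DecidableEq S] [DecidableEq A] [DecidableEq D]
variable {L j : ℕ}

/-- `N(s, d)`: the number of past steps in which agent `d` had control in state `s`. -/
def cntSD (h : History S A D L j) (s : S) (d : D) : ℕ :=
  ∑ l : Fin j, ∑ t : Fin L, if ((h l).2 t).1 = s ∧ ((h l).2 t).2.1 = d then 1 else 0

/-- `N(s, d, a)`: the number of past steps in which agent `d` took action `a` in state `s`. -/
def cntSDA (h : History S A D L j) (s : S) (d : D) (a : A) : ℕ :=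
  ∑ l : Fin j, ∑ t : Fin L,
    if ((h l).2 t).1 = s ∧ ((h l).2 t).2.1 = d ∧ ((h l).2 t).2.2.1 = a then 1 else 0

/-- `N'(s, a)`: the number of past steps in which action `a` was taken in state `s`. -/
def cntSA (h : History S A D L j) (s : S) (a : A) : ℕ :=
  ∑ l : Fin j, ∑ t : Fin L, if ((h l).2 t).1 = s ∧ ((h l).2 t).2.2.1 = a then 1 else 0

/-- `N'(s, a, s')`: the number of past steps in which action `a` in state `s` led to `s'`. -/
def cntSAS (h : History S A D L j) (s : S) (a : A) (s' : S) : ℕ :=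
  ∑ l : Fin j, ∑ t : Fin L,
    if ((h l).2 t).1 = s ∧ ((h l).2 t).2.2.1 = a ∧ ((h l).2 t).2.2.2 = s' then 1 else 0

/-- The empirical policy of agent `d` in state `s`. -/
def empAgent (h : History S A D L j) (s : S) (d : D) (a : A) : ℝ :=
  if cntSD h s d ≠ 0 then (cntSDA h s d a : ℝ) / (cntSD h s d : ℝ) else 1 / (Fintype.card A : ℝ)

/-- The empirical transition probabilities from the state `s` under the action `a`. -/
def empTrans (h : History S A D L j) (s : S) (a : A) (s' : S) : ℝ :=
  if cntSA h s a ≠ 0 then (cntSAS h s a s' : ℝ) / (cntSA h s a : ℝ) else 1 / (Fintype.card S : ℝ)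

/-- The confidence radius for the policy of agent `d` in state `s` after `j ≥ 1` episodes, that is,
in episode `k = j + 1`. -/
def radAgent (δ : ℝ) (h : History S A D L j) (s : S) (d : D) : ℝ :=
  √(2 * Real.log ((j : ℝ) ^ 7 * (L : ℝ) ^ 7 * (Fintype.card S : ℝ) * (Fintype.card D : ℝ) *
    2 ^ (Fintype.card A + 1) / δ) / max 1 (cntSD h s d : ℝ))

/-- The confidence radius for the transition law from `(s, a)` after `j ≥ 1` episodes. -/
def radTrans (δ : ℝ) (h : History S A D L j) (s : S) (a : A) : ℝ :=
  √(2 * Real.log ((j : ℝ) ^ 7 * (L : ℝ) ^ 7 * (Fintype.card S : ℝ) * (Fintype.card A : ℝ) *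
    2 ^ (Fintype.card S + 1) / δ) / max 1 (cntSA h s a : ℝ))

/-- The `L¹` confidence set for the policy of agent `d` in state `s` (the same at all times). -/
def confAgent (δ : ℝ) (h : History S A D L j) (s : S) (d : D) : Set (A → ℝ) :=
  {p | p ∈ stdSimplex ℝ A ∧ ∑ a, |p a - empAgent h s d a| ≤ radAgent δ h s d}

/-- The `L¹` confidence set for the transition law from `(s, a)` (the same at all times). -/
def confTrans (δ : ℝ) (h : History S A D L j) (s : S) (a : A) : Set (S → ℝ) :=
  {q | q ∈ stdSimplex ℝ S ∧ ∑ s', |q s' - empTrans h s a s'| ≤ radTrans δ h s a}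

/-- The objective of the optimistic Bellman minimization: the cost of giving control to `d'` in
`(s, d)`, for the most favourable agent policy and transition probabilities in the
confidence sets, if `V` is the cost-to-go at the next time. The sets are compact and non-empty, so
the infima are minima. -/
def optimisticQ (c : Costs S A D) (δ : ℝ) (h : History S A D L j) (V : S → D → ℝ)
    (s : S) (d d' : D) : ℝ :=
  c.ctrl d' + c.switch d' d +
    sInf ((fun p : A → ℝ => ∑ a, p a * (c.env s a +
      sInf ((fun q : S → ℝ => ∑ s', q s' * V s' d') '' confTrans δ h s a))) '' confAgent δ h s d')

/-- The optimistic value function computed by dynamic programming, with `n` steps to go. -/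
def optimisticV (c : Costs S A D) (δ : ℝ) (h : History S A D L j) : ℕ → S → D → ℝ
  | 0 => fun _ _ => 0
  | n + 1 => fun s d => ⨅ d' : D, optimisticQ c δ h (optimisticV c δ h n) s d d'

/-- `π` is a possible output of the dynamic program for the data `h`: at each time, state and
previous agent it picks a minimizer. After step `t` (counted from `0`) there are `L - (t + 1)`
steps to go. -/
def IsOptimistic (c : Costs S A D) (δ : ℝ) (h : History S A D L j) (π : Policy S D L) : Prop :=
  ∀ (t : Fin L) (s : S) (d d' : D),
    optimisticQ c δ h (optimisticV c δ h (L - (t + 1))) s d (π t s d) ≤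
      optimisticQ c δ h (optimisticV c δ h (L - (t + 1))) s d d'

/-- `alg`, which chooses the policy of an episode from the data of the `j` episodes before it,
is UCRL2-MC with some rule for breaking ties. In the first episode (`j = 0`) there are no data and
the radii, which contain `log 0`, are undefined; the first policy may be arbitrary. -/
def IsUCRL2MC (c : Costs S A D) (δ : ℝ) (alg : ∀ j, History S A D L j → Policy S D L) : Prop :=
  ∀ j, 1 ≤ j → ∀ h : History S A D L j, IsOptimistic c δ h (alg j h)

end Learning

/-- The law of the data of the first `K` episodes. Before each episode the policy is chosen from
the data so far, the initial condition `(s_1, d_0)` is drawn (from a law which may depend on the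
data so far), and then the policy is deployed in the true environment. -/
def interaction {L : ℕ} (M : Dynamics S A D) (init : ∀ j, History S A D L j → PMF (S × D))
    (alg : ∀ j, History S A D L j → Policy S D L) : (K : ℕ) → PMF (History S A D L K)
  | 0 => PMF.pure Fin.elim0
  | K + 1 =>
      (interaction M init alg K).bind fun h =>
        (init K h).bind fun x =>
          (rollout M (alg K h) x.1 x.2).map fun τ =>
            (Fin.snoc h (x, τ) : History S A D L (K + 1))

/-- The data of the episodes before episode `k`. -/
def before {L K : ℕ} (h : History S A D L K) (k : Fin K) : History S A D L k :=
  fun i => h ⟨i, i.2.trans k.2⟩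

/-- The total regret of the policies deployed along `h`: the sum over the episodes of the expected
cost of the deployed policy minus that of an optimal policy, given the initial condition. -/
def regret [Fintype S] [Fintype A] [Fintype D] {L K : ℕ} (c : Costs S A D) (M : Dynamics S A D)
    (alg : ∀ j, History S A D L j → Policy S D L) (h : History S A D L K) : ℝ :=
  ∑ k : Fin K, (expCost c M (alg k (before h k)) (h k).1.1 (h k).1.2 -
    optCost c M L (h k).1.1 (h k).1.2)

/-- The regret bound, with `T` the number of time steps. -/
def regretBound (ρ₁ ρ₂ : ℝ) (nS nA nD L : ℕ) (T δ : ℝ) : ℝ :=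
  ρ₁ * L * √(nA * nS * nD * T * Real.log (nS * nD * T / δ)) +
    ρ₂ * L * nS * √(nA * T * Real.log (nS * nA * T / δ))

end

end SwitchMDP

/-! The proof combines optimism with confidence sets. On a likely event the true laws lie in all
confidence sets that rest on at least two steps. The dynamic program then minimizes over a family of
models containing the true one, so its value is at most the cost of every policy
(`optimisticV_le_expCost`). The regret of an episode is therefore at most the gap between the true
cost of the deployed policy and its optimistic value. Unrolling the Bellman recursion bounds this
gap by `2 * L` times the expected sum of the truncated radii along the trajectory
(`expCost_le_optimisticV_add`).

The confidence sets are controlled by an exponential supermartingale for each subset of outcomes,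
with a union bound over the subsets and over the values of the random sample size
(`ev_deviationSet_le`).

The expected radii must still be compared with the radii met on the realized trajectories. Azuma's
inequality over episodes would leave a term of order `L ^ 2 * √K`, up to logarithms, which is too
large by a factor `√L`. Since the sums are non-negative and at most `2 * L`, `ev_sum_ev_gt_le`
bounds the former by twice the latter plus `O(L * log (1 / δ))`. Along the data, radii of order `1 /
√N` add up to the square root of the number of steps, although counts are only updated between
episodes (`sum_mul_bonus_le`, `sum_sum_bonus_le`).

What remains besides the square roots is of order `L ^ 2`, up to cardinalities and a logarithm.
`le_regretBound` absorbs it into the first root when `T` is large; for small `T` the trivial bound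
`R ≤ T` is enough. -/

namespace SwitchMDP

noncomputable section

/-! ### Expectations on finite types and Hoeffding's lemma. -/

section Expectation

variable {α β : Type*} [Fintype α] [Fintype β]

/-- The expectation of a real function under a probability mass function on a finite type. -/
def ev (p : PMF α) (f : α → ℝ) : ℝ := ∑ x, (p x).toReal * f x

theorem sum_toReal_eq_one (p : PMF α) : ∑ x, (p x).toReal = 1 := by
  have h := p.tsum_coe
  rw [tsum_fintype] at h
  rw [← ENNReal.toReal_sum fun x _ => p.apply_ne_top x, h, ENNReal.toReal_one]

theorem toReal_mem_stdSimplex (p : PMF α) : (fun x => (p x).toReal) ∈ stdSimplex ℝ α :=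
  ⟨fun _ => ENNReal.toReal_nonneg, sum_toReal_eq_one p⟩

theorem ev_const (p : PMF α) (r : ℝ) : ev p (fun _ => r) = r := by
  rw [ev, ← Finset.sum_mul, sum_toReal_eq_one, one_mul]

theorem ev_mono (p : PMF α) {f g : α → ℝ} (h : ∀ x, f x ≤ g x) : ev p f ≤ ev p g :=
  Finset.sum_le_sum fun x _ => mul_le_mul_of_nonneg_left (h x) ENNReal.toReal_nonneg

theorem ev_le (p : PMF α) {f : α → ℝ} {r : ℝ} (h : ∀ x, f x ≤ r) : ev p f ≤ r :=
  (ev_mono p h).trans_eq (ev_const p r)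

theorem le_ev (p : PMF α) {f : α → ℝ} {r : ℝ} (h : ∀ x, r ≤ f x) : r ≤ ev p f :=
  (ev_const p r).symm.trans_le (ev_mono p h)

theorem ev_add (p : PMF α) (f g : α → ℝ) : ev p (fun x => f x + g x) = ev p f + ev p g := by
  simp [ev, mul_add, Finset.sum_add_distrib]

theorem ev_sub (p : PMF α) (f g : α → ℝ) : ev p (fun x => f x - g x) = ev p f - ev p g := by
  simp [ev, mul_sub, Finset.sum_sub_distrib]

theorem ev_const_mul (p : PMF α) (r : ℝ) (f : α → ℝ) :
    ev p (fun x => r * f x) = r * ev p f := by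
  rw [ev, ev, Finset.mul_sum]
  exact Finset.sum_congr rfl fun x _ => by ring

theorem ev_sum {ι : Type*} (p : PMF α) (s : Finset ι) (f : ι → α → ℝ) :
    ev p (fun x => ∑ i ∈ s, f i x) = ∑ i ∈ s, ev p (f i) := by
  simp only [ev, Finset.mul_sum]
  exact Finset.sum_comm

theorem ev_pure (a : α) (f : α → ℝ) : ev (PMF.pure a) f = f a := by
  classical
  rw [ev, Finset.sum_eq_single a]
  · simp
  · intro b _ hb
    simp [PMF.pure_apply, hb]
  · simp

theorem ev_bind (p : PMF α) (q : α → PMF β) (f : β → ℝ) :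
    ev (p.bind q) f = ev p fun x => ev (q x) f := by
  have h : ∀ y, ((p.bind q) y).toReal = ∑ x, (p x).toReal * (q x y).toReal := by
    intro y
    rw [PMF.bind_apply, tsum_fintype, ENNReal.toReal_sum]
    · simp [ENNReal.toReal_mul]
    · exact fun x _ => ENNReal.mul_ne_top (p.apply_ne_top x) ((q x).apply_ne_top y)
  simp only [ev, h, Finset.sum_mul, Finset.mul_sum]
  rw [Finset.sum_comm]
  exact Finset.sum_congr rfl fun x _ => Finset.sum_congr rfl fun y _ => by ring

theorem ev_map (p : PMF α) (g : α → β) (f : β → ℝ) : ev (p.map g) f = ev p fun x => f (g x) := by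
  rw [PMF.map, ev_bind]
  exact congrArg _ (funext fun x => ev_pure _ _)

theorem toOuterMeasure_eq_ev (p : PMF α) (s : Set α) :
    p.toOuterMeasure s = ENNReal.ofReal (ev p (s.indicator 1)) := by
  rw [PMF.toOuterMeasure_apply, tsum_fintype, ev, ENNReal.ofReal_sum_of_nonneg]
  · refine Finset.sum_congr rfl fun x _ => ?_
    by_cases hx : x ∈ s <;> simp [hx, ENNReal.ofReal_toReal (p.apply_ne_top x)]
  · exact fun x _ => mul_nonneg ENNReal.toReal_nonneg (Set.indicator_nonneg (by simp) _)

/-- Hoeffding's lemma for the indicator of a set. -/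
theorem ev_exp_indicator_le [DecidableEq α] (p : PMF α) (B : Finset α) (l : ℝ) :
    ev p (fun x => Real.exp (l * ((if x ∈ B then 1 else 0) - ∑ y ∈ B, (p y).toReal) - l ^ 2 / 8))
      ≤ 1 := by
  let _ : MeasurableSpace α := ⊤
  have _ : DiscreteMeasurableSpace α := ⟨fun _ => trivial⟩
  -- A variable in an interval of length one has sub-Gaussian parameter `(1 / 2) ^ 2`, which gives
  -- the exponent `l ^ 2 / 8`.
  have key := (ProbabilityTheory.hasSubgaussianMGF_of_mem_Icc (μ := p.toMeasure)
    (X := fun x => if x ∈ B then (1 : ℝ) else 0) (a := 0) (b := 1)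
    (measurable_of_countable _).aemeasurable
    (Filter.Eventually.of_forall fun x => by split_ifs <;> simp)).mgf_le l
  have hm : ∑ x, (p x).toReal * (if x ∈ B then (1 : ℝ) else 0) = ∑ y ∈ B, (p y).toReal := by
    simp [Finset.sum_ite_mem]
  rw [ProbabilityTheory.mgf, PMF.integral_eq_sum, PMF.integral_eq_sum] at key
  simp only [smul_eq_mul, hm] at key
  calc _ = Real.exp (-(l ^ 2 / 8)) * ∑ x, (p x).toReal *
        Real.exp (l * ((if x ∈ B then 1 else 0) - ∑ y ∈ B, (p y).toReal)) := by
        rw [ev, Finset.mul_sum]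
        refine Finset.sum_congr rfl fun x _ => ?_
        rw [sub_eq_add_neg, Real.exp_add]
        ring
    _ ≤ Real.exp (-(l ^ 2 / 8)) * Real.exp (l ^ 2 / 8) := by
        refine mul_le_mul_of_nonneg_left (key.trans (le_of_eq ?_)) (Real.exp_pos _).le
        congr 1
        simp
        ring
    _ = 1 := by rw [← Real.exp_add]; simp

end Expectation

/-! ### Expectations along trajectories and along the whole interaction. -/

section Interaction

theorem before_snoc_castSucc {S : Type u} {A : Type v} {D : Type w} {L K : ℕ}
    (h : History S A D L K) (e : Episode S A D L) (k : Fin K) :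
    before (Fin.snoc h e : History S A D L (K + 1)) k.castSucc = before h k := by
  funext i
  exact Fin.snoc_castSucc (α := fun _ => Episode S A D L) e h ⟨i, i.2.trans k.2⟩

theorem before_snoc_last {S : Type u} {A : Type v} {D : Type w} {L K : ℕ}
    (h : History S A D L K) (e : Episode S A D L) :
    before (Fin.snoc h e : History S A D L (K + 1)) (Fin.last K) = h := by
  funext i
  exact Fin.snoc_castSucc (α := fun _ => Episode S A D L) e h i

variable {S : Type u} {A : Type v} {D : Type w} [Fintype S] [Fintype A] [Fintype D]
variable {L : ℕ}

theorem ev_rollout_succ (M : Dynamics S A D) {n : ℕ} (π : Policy S D (n + 1)) (s : S) (d : D)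
    (f : Traj S A D (n + 1) → ℝ) :
    ev (rollout M π s d) f = ev (M.agent (π 0 s d) s) fun a => ev (M.trans s a) fun s' =>
      ev (rollout M (n := n) (Fin.tail π) s' (π 0 s d)) fun τ =>
        f (Fin.cons (s, π 0 s d, a, s') τ : Traj S A D (n + 1)) := by
  rw [rollout, ev_bind]
  simp only [ev_bind, ev_map]

/-- The supermartingale property within an episode: by induction the later steps contribute a factor
at most one, whatever the outcome of the first step. -/
theorem ev_rollout_prod_le_one (M : Dynamics S A D) (g : Step S A D → ℝ) (hg : ∀ x, 0 ≤ g x)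
    (h1 : ∀ s d, ev (M.agent d s) (fun a => ev (M.trans s a) fun s' => g (s, d, a, s')) ≤ 1)
    {n : ℕ} (π : Policy S D n) (s : S) (d : D) :
    ev (rollout M π s d) (fun τ => ∏ t, g (τ t)) ≤ 1 := by
  induction n generalizing s d with
  | zero => exact ev_le _ fun τ => by simp
  | succ n ih =>
    rw [ev_rollout_succ]
    refine le_trans (ev_mono _ fun a => ev_mono _ fun s' => ?_) (h1 s (π 0 s d))
    simp only [Fin.prod_univ_succ, Fin.cons_zero, Fin.cons_succ, ev_const_mul]
    exact mul_le_of_le_one_right (hg _) (ih _ _ _)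

variable (M : Dynamics S A D) (init : ∀ j, History S A D L j → PMF (S × D))
  (alg : ∀ j, History S A D L j → Policy S D L)

theorem ev_interaction_succ (K : ℕ) (f : History S A D L (K + 1) → ℝ) :
    ev (interaction M init alg (K + 1)) f = ev (interaction M init alg K) fun h =>
      ev (init K h) fun x => ev (rollout M (alg K h) x.1 x.2) fun τ =>
        f (Fin.snoc h (x, τ) : History S A D L (K + 1)) := by
  rw [interaction, ev_bind]
  simp only [ev_bind, ev_map]

/-- The data before episode `k` have the law of the interaction of `k` episodes. -/
theorem ev_interaction_before {K : ℕ} (k : Fin K) (f : History S A D L k → ℝ) :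
    ev (interaction M init alg K) (fun h => f (before h k)) = ev (interaction M init alg k) f := by
  induction K with
  | zero => exact k.elim0
  | succ K ih =>
    rw [ev_interaction_succ]
    induction k using Fin.lastCases with
    | last => simp only [before_snoc_last, ev_const]; rfl
    | cast k =>
      simp only [before_snoc_castSucc, ev_const]
      exact ih k f

/-- A product of conditionally sub-unit non-negative factors has expectation at most one. -/
theorem ev_interaction_prod_le_one (W : ∀ j, History S A D L j → Episode S A D L → ℝ)
    (hW : ∀ j h e, 0 ≤ W j h e)
    (h1 : ∀ j h x, ev (rollout M (alg j h) x.1 x.2) (fun τ => W j h (x, τ)) ≤ 1) (K : ℕ) :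
    ev (interaction M init alg K) (fun h => ∏ k : Fin K, W k (before h k) (h k)) ≤ 1 := by
  induction K with
  | zero => exact ev_le _ fun h => by simp
  | succ K ih =>
    rw [ev_interaction_succ]
    refine le_trans (ev_mono _ fun h => ?_) ih
    -- The bound `h1` is uniform in the initial condition, so the law `init` plays no role.
    refine ev_le _ fun x => ?_
    simp only [Fin.prod_univ_castSucc, before_snoc_castSucc, before_snoc_last, Fin.snoc_castSucc,
      Fin.snoc_last, Fin.val_castSucc, Fin.val_last, ev_const_mul]
    exact mul_le_of_le_one_right (Finset.prod_nonneg fun k _ => hW _ _ _) (h1 K h x)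

end Interaction

/-! ### `L¹` concentration of empirical laws after a random number of samples. -/

section Concentration

variable {S : Type u} {A : Type v} {D : Type w} {L j : ℕ}

/-- The number of past steps which satisfy `P`. -/
def cnt (P : Step S A D → Prop) [DecidablePred P] (h : History S A D L j) : ℕ :=
  ∑ l : Fin j, ∑ t : Fin L, if P ((h l).2 t) then 1 else 0

theorem cnt_le (P : Step S A D → Prop) [DecidablePred P] (h : History S A D L j) :
    cnt P h ≤ j * L := by
  calc cnt P h ≤ ∑ _l : Fin j, ∑ _t : Fin L, 1 :=
        Finset.sum_le_sum fun l _ => Finset.sum_le_sum fun t _ => by split_ifs <;> simp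
    _ = j * L := by simp

theorem sum_cnt_and {Ω : Type*} [DecidableEq Ω] (P : Step S A D → Prop)
    [DecidablePred P] (o : Step S A D → Ω) (B : Finset Ω) (h : History S A D L j) :
    ∑ y ∈ B, cnt (fun x => P x ∧ o x = y) h = cnt (fun x => P x ∧ o x ∈ B) h := by
  simp only [cnt]
  rw [Finset.sum_comm]
  refine Finset.sum_congr rfl fun l _ => ?_
  rw [Finset.sum_comm]
  refine Finset.sum_congr rfl fun t _ => ?_
  by_cases hP : P ((h l).2 t) <;> simp [hP]

/-- Positive and negative parts have equal mass. This reduces an `L¹` deviation to the deviation on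
one subset of outcomes, and the union over subsets is the source of the factor `2 ^ card Ω`. -/
theorem sum_abs_eq_of_sum_eq_zero {Ω : Type*} [Fintype Ω] {y : Ω → ℝ} (hy : ∑ x, y x = 0) :
    ∑ x, |y x| = 2 * ∑ x with 0 < y x, y x := by
  have : ∀ x, |y x| = 2 * (if 0 < y x then y x else 0) - y x := by
    intro x
    split_ifs with h
    · rw [abs_of_pos h]; ring
    · rw [abs_of_nonpos (not_lt.1 h)]; ring
  simp only [this, Finset.sum_sub_distrib, hy, ← Finset.mul_sum, Finset.sum_filter, sub_zero]

variable [Fintype S] [Fintype A] [Fintype D]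
variable {Ω : Type*} [Fintype Ω] [DecidableEq Ω]

/-- The exponential weight of a step in the Hoeffding supermartingale of the event `o ∈ B` along the
steps which satisfy `P`. -/
def expWeight (P : Step S A D → Prop) [DecidablePred P] (o : Step S A D → Ω) (p : PMF Ω)
    (B : Finset Ω) (l : ℝ) (x : Step S A D) : ℝ :=
  Real.exp (if P x then l * ((if o x ∈ B then 1 else 0) - ∑ y ∈ B, (p y).toReal) - l ^ 2 / 8 else 0)

/-- Conditionally on the past, the outcome `o` of a step which satisfies `P` has law `p`, as far as
exponential moments of indicators are concerned. -/
def IsSampling (M : Dynamics S A D) (P : Step S A D → Prop) [DecidablePred P]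
    (o : Step S A D → Ω) (p : PMF Ω) : Prop :=
  ∀ (B : Finset Ω) (l : ℝ) (s : S) (d : D), ev (M.agent d s) (fun a =>
    ev (M.trans s a) fun s' => expWeight P o p B l (s, d, a, s')) ≤ 1

theorem prod_expWeight (P : Step S A D → Prop) [DecidablePred P] (o : Step S A D → Ω) (p : PMF Ω)
    (B : Finset Ω) (l : ℝ) (h : History S A D L j) :
    ∏ k : Fin j, ∏ t : Fin L, expWeight P o p B l ((h k).2 t) =
      Real.exp (l * ∑ y ∈ B, ((cnt (fun x => P x ∧ o x = y) h : ℝ) -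
        (cnt P h : ℝ) * (p y).toReal) - l ^ 2 / 8 * cnt P h) := by
  have hB : ∑ y ∈ B, ((cnt (fun x => P x ∧ o x = y) h : ℝ) - (cnt P h : ℝ) * (p y).toReal) =
      (cnt (fun x => P x ∧ o x ∈ B) h : ℝ) - (cnt P h : ℝ) * ∑ y ∈ B, (p y).toReal := by
    rw [Finset.sum_sub_distrib, Finset.mul_sum, ← Nat.cast_sum, sum_cnt_and]
  rw [hB]
  have hN : ∀ (Q : Step S A D → Prop) [DecidablePred Q], (cnt Q h : ℝ) =
      ∑ k : Fin j, ∑ t : Fin L, if Q ((h k).2 t) then 1 else 0 := fun Q _ => by simp [cnt]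
  simp only [expWeight, ← Real.exp_sum]
  generalize ∑ y ∈ B, (p y).toReal = b
  rw [hN, hN P, Finset.sum_mul, ← Finset.sum_sub_distrib, Finset.mul_sum, Finset.mul_sum,
    ← Finset.sum_sub_distrib]
  congr 1
  refine Finset.sum_congr rfl fun k _ => ?_
  rw [Finset.sum_mul, ← Finset.sum_sub_distrib, Finset.mul_sum, Finset.mul_sum,
    ← Finset.sum_sub_distrib]
  refine Finset.sum_congr rfl fun t _ => ?_
  by_cases hP : P ((h k).2 t) <;> by_cases ho : o ((h k).2 t) ∈ B <;> simp [hP, ho]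

variable (M : Dynamics S A D) (init : ∀ j, History S A D L j → PMF (S × D))
  (alg : ∀ j, History S A D L j → Policy S D L)

theorem ev_prod_expWeight_le_one {P : Step S A D → Prop} [DecidablePred P] {o : Step S A D → Ω}
    {p : PMF Ω} (hs : IsSampling M P o p) (B : Finset Ω) (l : ℝ) :
    ev (interaction M init alg j)
      (fun h => ∏ k : Fin j, ∏ t : Fin L, expWeight P o p B l ((h k).2 t)) ≤ 1 := by
  have h := ev_interaction_prod_le_one M init alg
    (fun _ _ e => ∏ t, expWeight P o p B l (e.2 t))
    (fun _ _ _ => Finset.prod_nonneg fun _ _ => (Real.exp_pos _).le)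
    (fun j h x => ev_rollout_prod_le_one M (expWeight P o p B l) (fun _ => (Real.exp_pos _).le)
      (hs B l) (alg j h) x.1 x.2) j
  exact h

/-- The data for which the empirical law of `o` deviates from `p` by more than
`√(2 log X / N)` in `L¹`, where `N` is the number of observations. -/
def deviationSet (L j : ℕ) (P : Step S A D → Prop) [DecidablePred P] (o : Step S A D → Ω)
    (p : PMF Ω) (X : ℝ) : Set (History S A D L j) :=
  {h | cnt P h ≠ 0 ∧ √(2 * Real.log X / cnt P h) <
    ∑ y, |(cnt (fun x => P x ∧ o x = y) h : ℝ) / cnt P h - (p y).toReal|}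

/-- The `L¹` deviation inequality for the empirical law after a random number of samples. -/
theorem ev_deviationSet_le {P : Step S A D → Prop} [DecidablePred P] {o : Step S A D → Ω}
    {p : PMF Ω} (hs : IsSampling M P o p) {X : ℝ} (hX : 1 ≤ X) :
    ev (interaction M init alg j) ((deviationSet L j P o p X).indicator 1) ≤
      j * L * 2 ^ Fintype.card Ω / X := by
  have hX0 : 0 < X := by linarith
  let r : ℕ → ℝ := fun n => √(2 * Real.log X / n)
  -- The best exponent depends on the sample size, which is random; hence the sum over all its
  -- possible values `n`, with exponent `2 * r n` for each. The bad subset `B` is random too.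
  have hpt : ∀ h : History S A D L j, (deviationSet L j P o p X).indicator (1 : History S A D L j → ℝ) h ≤
      ∑ n ∈ Finset.Icc 1 (j * L), ∑ B : Finset Ω, X⁻¹ *
        ∏ k : Fin j, ∏ t : Fin L, expWeight P o p B (2 * r n) ((h k).2 t) := by
    intro h
    have hnn : ∀ n (B : Finset Ω), 0 ≤ X⁻¹ *
        ∏ k : Fin j, ∏ t : Fin L, expWeight P o p B (2 * r n) ((h k).2 t) := fun n B =>
      mul_nonneg (by positivity) (Finset.prod_nonneg fun _ _ => Finset.prod_nonneg fun _ _ =>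
        (Real.exp_pos _).le)
    by_cases hh : h ∈ deviationSet L j P o p X
    · rw [Set.indicator_of_mem hh, Pi.one_apply]
      obtain ⟨hn0, hr⟩ := hh
      set n := cnt P h with hn
      have hnpos : (0 : ℝ) < n := by exact_mod_cast Nat.pos_of_ne_zero hn0
      have hsum : ∑ y, ((cnt (fun x => P x ∧ o x = y) h : ℝ) / n - (p y).toReal) = 0 := by
        rw [Finset.sum_sub_distrib, sum_toReal_eq_one, ← Finset.sum_div, ← Nat.cast_sum, sum_cnt_and]
        simp only [Finset.mem_univ, and_true]
        rw [← hn, div_self hnpos.ne', sub_self]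
      rw [sum_abs_eq_of_sum_eq_zero hsum] at hr
      set B : Finset Ω := Finset.univ.filter
        fun y => 0 < (cnt (fun x => P x ∧ o x = y) h : ℝ) / n - (p y).toReal
      have hterm : 1 ≤ X⁻¹ *
          ∏ k : Fin j, ∏ t : Fin L, expWeight P o p B (2 * r n) ((h k).2 t) := by
        rw [prod_expWeight, ← hn]
        have hr2 : r n ^ 2 * n = 2 * Real.log X := by
          rw [Real.sq_sqrt (div_nonneg (mul_nonneg two_pos.le (Real.log_nonneg hX)) hnpos.le)]
          field_simp
        have hY : ∑ y ∈ B, ((cnt (fun x => P x ∧ o x = y) h : ℝ) - (n : ℝ) * (p y).toReal) =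
            n * ∑ y ∈ B, ((cnt (fun x => P x ∧ o x = y) h : ℝ) / n - (p y).toReal) := by
          rw [Finset.mul_sum]
          exact Finset.sum_congr rfl fun y _ => by field_simp
        rw [hY]
        set Y := ∑ y ∈ B, ((cnt (fun x => P x ∧ o x = y) h : ℝ) / n - (p y).toReal)
        have hr0 : 0 ≤ r n := Real.sqrt_nonneg _
        -- The `L¹` deviation is `2 * Y`, so `r n < 2 * Y`, and the right side is at least `r n ^ 2
        -- * n - r n ^ 2 * n / 2 = log X`.
        have hlog : Real.log X ≤ 2 * r n * (n * Y) - (2 * r n) ^ 2 / 8 * n := by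
          have : r n * n * (r n) ≤ r n * n * (2 * Y) :=
            mul_le_mul_of_nonneg_left hr.le (by positivity)
          nlinarith
        rw [inv_mul_eq_div, one_le_div hX0]
        exact (Real.exp_log hX0).symm.trans_le (Real.exp_le_exp.2 hlog)
      refine hterm.trans (le_trans ?_ (Finset.single_le_sum
        (fun m _ => Finset.sum_nonneg fun B _ => hnn m B)
        (Finset.mem_Icc.2 ⟨Nat.pos_of_ne_zero hn0, cnt_le P h⟩)))
      exact Finset.single_le_sum (fun B _ => hnn n B) (Finset.mem_univ B)
    · rw [Set.indicator_of_notMem hh]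
      exact Finset.sum_nonneg fun n _ => Finset.sum_nonneg fun B _ => hnn n B
  refine (ev_mono _ hpt).trans ?_
  simp only [ev_sum, ev_const_mul]
  calc _ ≤ ∑ n ∈ Finset.Icc 1 (j * L), ∑ B : Finset Ω, X⁻¹ * 1 :=
        Finset.sum_le_sum fun n _ => Finset.sum_le_sum fun B _ =>
          mul_le_mul_of_nonneg_left (ev_prod_expWeight_le_one M init alg hs B _) (by positivity)
    _ = j * L * 2 ^ Fintype.card Ω / X := by
        simp [Finset.card_univ, Fintype.card_finset]
        ring

theorem isSampling_agent [DecidableEq S] [DecidableEq A] [DecidableEq D] (s₀ : S) (d₀ : D) :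
    IsSampling M (fun x => x.1 = s₀ ∧ x.2.1 = d₀) (fun x => x.2.2.1) (M.agent d₀ s₀) := by
  intro B l s d
  by_cases h : s = s₀ ∧ d = d₀
  · obtain ⟨rfl, rfl⟩ := h
    simp only [expWeight, and_self, if_true]
    refine le_trans (ev_mono _ fun a => ?_) (ev_exp_indicator_le (M.agent d s) B l)
    exact ev_le _ fun s' => le_rfl
  · simp only [expWeight, h, if_false, Real.exp_zero, ev_const, le_refl]

/-- Given the state and the action, the next state has the law `M.trans s a` whichever agent acted,
so the bound already holds for each action separately. -/
theorem isSampling_trans [DecidableEq S] [DecidableEq A] (s₀ : S) (a₀ : A) :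
    IsSampling M (fun x => x.1 = s₀ ∧ x.2.2.1 = a₀) (fun x => x.2.2.2) (M.trans s₀ a₀) := by
  intro B l s d
  refine ev_le _ fun a => ?_
  by_cases h : s = s₀ ∧ a = a₀
  · obtain ⟨rfl, rfl⟩ := h
    simp only [expWeight, and_self, if_true]
    exact ev_exp_indicator_le _ B l
  · simp only [expWeight, h, if_false, Real.exp_zero, ev_const, le_refl]

end Concentration

/-! ### Optimism, and the gap between the optimistic value and the true cost. -/

section DynamicProgramming

theorem le_sum_stdSimplex_mul {α : Type*} [Fintype α] {p f : α → ℝ} {r : ℝ}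
    (hp : p ∈ stdSimplex ℝ α) (hf : ∀ a, r ≤ f a) : r ≤ ∑ a, p a * f a := by
  calc r = ∑ a, p a * r := by rw [← Finset.sum_mul, hp.2, one_mul]
    _ ≤ _ := Finset.sum_le_sum fun a _ => mul_le_mul_of_nonneg_left (hf a) (hp.1 a)

/-- The smallest average of `f` over an `L¹` ball in the simplex, compared with the average under a
point `p` of the ball. -/
theorem sInf_average_bounds {α : Type*} [Fintype α] {p q f : α → ℝ} {r lo H : ℝ}
    {C : Set (α → ℝ)} (hC : C = {p | p ∈ stdSimplex ℝ α ∧ ∑ a, |p a - q a| ≤ r}) (hp : p ∈ C)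
    (hlo : ∀ a, lo ≤ f a) (hhi : ∀ a, f a ≤ lo + H) (hH : 0 ≤ H) :
    lo ≤ sInf ((fun p : α → ℝ => ∑ a, p a * f a) '' C) ∧
    sInf ((fun p : α → ℝ => ∑ a, p a * f a) '' C) ≤ ∑ a, p a * f a ∧
    ∑ a, p a * f a ≤ sInf ((fun p : α → ℝ => ∑ a, p a * f a) '' C) + 2 * H * min 1 r := by
  subst hC
  have hlb : ∀ y ∈ (fun p : α → ℝ => ∑ a, p a * f a) ''
      {p | p ∈ stdSimplex ℝ α ∧ ∑ a, |p a - q a| ≤ r}, lo ≤ y := by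
    rintro _ ⟨p', hp', rfl⟩
    exact le_sum_stdSimplex_mul hp'.1 hlo
  refine ⟨le_csInf ⟨_, p, hp, rfl⟩ hlb, csInf_le ⟨lo, hlb⟩ ⟨p, hp, rfl⟩, ?_⟩
  rw [← sub_le_iff_le_add]
  refine le_csInf ⟨_, p, hp, rfl⟩ ?_
  rintro _ ⟨p', hp', rfl⟩
  have h1 : ∑ a, |p a - p' a| ≤ 2 * r := by
    calc _ ≤ ∑ a, (|p a - q a| + |p' a - q a|) := Finset.sum_le_sum fun a _ => by
            rw [abs_sub_comm (p' a)]; exact abs_sub_le _ _ _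
      _ ≤ 2 * r := by rw [Finset.sum_add_distrib]; linarith [hp.2, hp'.2]
  -- Distributions are at `L¹` distance at most two, which is why the radius can be truncated at
  -- one.
  have h2 : ∑ a, |p a - p' a| ≤ 2 := by
    calc _ ≤ ∑ a, (p a + p' a) := Finset.sum_le_sum fun a _ => by
            rw [abs_le]; constructor <;> linarith [hp.1.1 a, hp'.1.1 a]
      _ = 2 := by rw [Finset.sum_add_distrib, hp.1.2, hp'.1.2]; norm_num
  have h3 : ∑ a, p a * f a - ∑ a, p' a * f a ≤ H * ∑ a, |p a - p' a| := by
    -- Both laws have mass one, so `f` may be shifted into `[0, H]`.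
    have e : ∑ a, p a * f a - ∑ a, p' a * f a = ∑ a, (p a - p' a) * (f a - lo) := by
      simp only [sub_mul, mul_sub, Finset.sum_sub_distrib, ← Finset.sum_mul, hp.1.2, hp'.1.2]
      ring
    rw [e, Finset.mul_sum]
    refine Finset.sum_le_sum fun a _ => ?_
    calc (p a - p' a) * (f a - lo) ≤ |p a - p' a| * (f a - lo) :=
          mul_le_mul_of_nonneg_right (le_abs_self _) (by linarith [hlo a])
      _ ≤ H * |p a - p' a| := by
          rw [mul_comm]; exact mul_le_mul_of_nonneg_right (by linarith [hhi a]) (abs_nonneg _)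
  have h4 : ∑ a, |p a - p' a| ≤ 2 * min 1 r := by
    rcases min_cases 1 r with h | h <;> rw [h.1] <;> linarith
  have := mul_le_mul_of_nonneg_left h4 hH
  show _ ≤ ∑ a, p' a * f a
  linarith

variable {S : Type u} {A : Type v} {D : Type w} [Fintype S] [Fintype A] [Fintype D]
variable {L j : ℕ} (c : Costs S A D) (M : Dynamics S A D)

theorem expCost_eq_ev {n : ℕ} (π : Policy S D n) (s : S) (d : D) :
    expCost c M π s d = ev (rollout M π s d) (trajCost c d) := rfl

theorem expCost_zero (π : Policy S D 0) (s : S) (d : D) : expCost c M π s d = 0 := by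
  rw [expCost_eq_ev, rollout, ev_pure]
  simp [trajCost]

theorem trajCost_cons {n : ℕ} (d s d' a s') (τ : Traj S A D n) :
    trajCost c d (Fin.cons (s, d', a, s') τ : Traj S A D (n + 1)) =
      c.env s a + c.ctrl d' + c.switch d' d + trajCost c d' τ := by
  unfold trajCost
  rw [Fin.sum_univ_succ]
  congr 1
  refine Finset.sum_congr rfl fun t _ => ?_
  rw [Fin.castSucc_succ]
  simp only [Fin.cons_succ]
  congr 2
  cases n with
  | zero => exact t.elim0
  | succ n => induction t using Fin.cases <;> rfl

theorem expCost_succ {n : ℕ} (π : Policy S D (n + 1)) (s : S) (d : D) :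
    expCost c M π s d = ev (M.agent (π 0 s d) s) fun a => ev (M.trans s a) fun s' =>
      c.env s a + c.ctrl (π 0 s d) + c.switch (π 0 s d) d +
        expCost c M (n := n) (Fin.tail π) s' (π 0 s d) := by
  rw [expCost_eq_ev, ev_rollout_succ]
  simp only [trajCost_cons, ev_add, ev_const, ← expCost_eq_ev]

theorem expCost_mem_Icc (hc : ∀ s a d d', 0 ≤ c.env s a + c.ctrl d + c.switch d d' ∧
      c.env s a + c.ctrl d + c.switch d d' ≤ 1) {n : ℕ} (π : Policy S D n) (s : S) (d : D) :
    0 ≤ expCost c M π s d ∧ expCost c M π s d ≤ n := by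
  have h : ∀ τ : Traj S A D n, 0 ≤ trajCost c d τ ∧ trajCost c d τ ≤ n := fun τ =>
    ⟨Finset.sum_nonneg fun t _ => (hc _ _ _ _).1,
      (Finset.sum_le_sum fun t _ => (hc _ _ _ _).2).trans_eq (by simp)⟩
  exact ⟨le_ev _ fun τ => (h τ).1, ev_le _ fun τ => (h τ).2⟩

theorem optCost_nonneg (hc : ∀ s a d d', 0 ≤ c.env s a + c.ctrl d + c.switch d d' ∧
      c.env s a + c.ctrl d + c.switch d d' ≤ 1) (n : ℕ) (s : S) (d : D) :
    0 ≤ optCost c M n s d :=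
  Real.iInf_nonneg fun π => (expCost_mem_Icc c M hc π s d).1

variable [DecidableEq S] [DecidableEq A] [DecidableEq D]

/-- The true laws lie in the confidence sets. -/
def IsPlausible (δ : ℝ) (h : History S A D L j) : Prop :=
  (∀ s d, (fun a => (M.agent d s a).toReal) ∈ confAgent δ h s d) ∧
    ∀ s a, (fun s' => (M.trans s a s').toReal) ∈ confTrans δ h s a

variable {c M} {δ : ℝ} {h : History S A D L j}
  (hc : ∀ s a d d', 0 ≤ c.env s a + c.ctrl d + c.switch d d' ∧
    c.env s a + c.ctrl d + c.switch d d' ≤ 1)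
  (hM : IsPlausible M δ h)
include hc hM

/-- One step of the optimistic Bellman recursion, compared with the true dynamics. -/
theorem optimisticQ_bounds {V : S → D → ℝ} {H : ℝ} (hH : 0 ≤ H)
    (hV : ∀ s d, 0 ≤ V s d ∧ V s d ≤ H) (s : S) (d d' : D) :
    0 ≤ optimisticQ c δ h V s d d' ∧
    optimisticQ c δ h V s d d' ≤ (ev (M.agent d' s) fun a => ev (M.trans s a) fun s' =>
      c.env s a + c.ctrl d' + c.switch d' d + V s' d') ∧
    (ev (M.agent d' s) fun a => ev (M.trans s a) fun s' =>
      c.env s a + c.ctrl d' + c.switch d' d + V s' d') ≤ optimisticQ c δ h V s d d' +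
      2 * (H + 1) * (ev (M.agent d' s) fun a => min 1 (radAgent δ h s d') +
        min 1 (radTrans δ h s a)) := by
  have hT := fun a => sInf_average_bounds (f := fun s' => V s' d') (lo := 0) (H := H)
    (C := confTrans δ h s a) rfl (hM.2 s a) (fun s' => (hV s' d').1)
    (fun s' => by linarith [(hV s' d').2]) hH
  set I : A → ℝ := fun a =>
    sInf ((fun q : S → ℝ => ∑ s', q s' * V s' d') '' confTrans δ h s a) with hI
  have hTe : ∀ a, ∑ s', (M.trans s a s').toReal * V s' d' = ev (M.trans s a) fun s' => V s' d' :=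
    fun _ => rfl
  have hIH : ∀ a, I a ≤ H := fun a => (hT a).2.1.trans (ev_le _ fun s' => (hV s' d').2)
  -- Only the total cost of a step is known to lie in `[0, 1]`, not `c.env` alone. The lower end
  -- `lo` offsets the control and switching costs.
  have hA := sInf_average_bounds (f := fun a => c.env s a + I a) (lo := -c.ctrl d' - c.switch d' d)
    (H := H + 1) (C := confAgent δ h s d') rfl (hM.1 s d')
    (fun a => by linarith [(hT a).1, (hc s a d' d).1])
    (fun a => by linarith [hIH a, (hc s a d' d).2]) (by linarith)
  have hQ : optimisticQ c δ h V s d d' = c.ctrl d' + c.switch d' d +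
    sInf ((fun p : A → ℝ => ∑ a, p a * (c.env s a + I a)) '' confAgent δ h s d') := rfl
  rw [hQ]
  have hAe : ∑ a, (M.agent d' s a).toReal * (c.env s a + I a) =
      ev (M.agent d' s) fun a => c.env s a + I a := rfl
  rw [hAe] at hA
  have hsplit : (ev (M.agent d' s) fun a => ev (M.trans s a) fun s' =>
      c.env s a + c.ctrl d' + c.switch d' d + V s' d') = c.ctrl d' + c.switch d' d +
      ev (M.agent d' s) fun a => c.env s a + ev (M.trans s a) fun s' => V s' d' := by
    rw [← ev_const (M.agent d' s) (c.ctrl d' + c.switch d' d), ← ev_add]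
    congr 1
    funext a
    rw [ev_add, ev_const]
    ring
  rw [hsplit]
  refine ⟨by linarith [hA.1], ?_, ?_⟩
  · have : (ev (M.agent d' s) fun a => c.env s a + I a) ≤
        ev (M.agent d' s) fun a => c.env s a + ev (M.trans s a) fun s' => V s' d' :=
      ev_mono _ fun a => by linarith [(hT a).2.1, hTe a]
    linarith [hA.2.1]
  · have : (ev (M.agent d' s) fun a => c.env s a + ev (M.trans s a) fun s' => V s' d') ≤
        (ev (M.agent d' s) fun a => c.env s a + I a) +
          2 * (H + 1) * ev (M.agent d' s) fun a => min 1 (radTrans δ h s a) := by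
      rw [← ev_const_mul, ← ev_add]
      refine ev_mono _ fun a => ?_
      have h0 : 0 ≤ min 1 (radTrans δ h s a) := le_min zero_le_one (Real.sqrt_nonneg _)
      linarith [(hT a).2.2, hTe a]
    rw [ev_add _ (fun _ => min 1 (radAgent δ h s d')), ev_const]
    linarith [hA.2.2]

theorem optimisticV_mem_Icc (n : ℕ) (s : S) (d : D) :
    0 ≤ optimisticV c δ h n s d ∧ optimisticV c δ h n s d ≤ n := by
  induction n generalizing s d with
  | zero => simp [optimisticV]
  | succ n ih =>
    have hb := fun d' => optimisticQ_bounds hc hM (Nat.cast_nonneg n) ih s d d'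
    refine ⟨Real.iInf_nonneg fun d' => (hb d').1, ?_⟩
    refine (ciInf_le ⟨0, by rintro _ ⟨d', rfl⟩; exact (hb d').1⟩ d).trans ((hb d).2.1.trans ?_)
    refine ev_le _ fun a => ev_le _ fun s' => ?_
    push_cast
    linarith [(ih s' d).2, (hc s a d d).2]

/-- Optimism: the optimistic value is at most the true cost of any policy. -/
theorem optimisticV_le_expCost {n : ℕ} (π : Policy S D n) (s : S) (d : D) :
    optimisticV c δ h n s d ≤ expCost c M π s d := by
  induction n generalizing s d with
  | zero => rw [expCost_zero]; exact le_rfl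
  | succ n ih =>
    have hb := fun d' => optimisticQ_bounds hc hM (Nat.cast_nonneg n)
      (optimisticV_mem_Icc hc hM n) s d d'
    refine (ciInf_le ⟨0, by rintro _ ⟨d', rfl⟩; exact (hb d').1⟩ (π 0 s d)).trans
      ((hb _).2.1.trans ?_)
    rw [expCost_succ]
    exact ev_mono _ fun a => ev_mono _ fun s' => by linarith [ih (Fin.tail π) s' (π 0 s d)]

/-- The cost of an optimistic policy exceeds the optimistic value by at most the expected sum of
the confidence radii along the trajectory. -/
theorem expCost_le_optimisticV_add {H : ℝ} {bD : S → D → ℝ} {bT : S → A → ℝ}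
    (hD : ∀ s d, min 1 (radAgent δ h s d) ≤ bD s d) (hT : ∀ s a, min 1 (radTrans δ h s a) ≤ bT s a)
    {n : ℕ} (hn : (n : ℝ) ≤ H) (π : Policy S D n)
    (hπ : ∀ (t : Fin n) (s : S) (d d' : D),
      optimisticQ c δ h (optimisticV c δ h (n - (t + 1))) s d (π t s d) ≤
        optimisticQ c δ h (optimisticV c δ h (n - (t + 1))) s d d') (s : S) (d : D) :
    expCost c M π s d ≤ optimisticV c δ h n s d + 2 * H * ev (rollout M π s d)
      (fun τ => ∑ t, (bD (τ t).1 (τ t).2.1 + bT (τ t).1 (τ t).2.2.1)) := by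
  induction n generalizing s d with
  | zero => rw [expCost_zero, rollout, ev_pure]; simp [optimisticV]
  | succ n ih =>
    have hne : Nonempty D := ⟨d⟩
    push_cast at hn
    have hn0 : (0 : ℝ) ≤ n := Nat.cast_nonneg n
    have hb := (optimisticQ_bounds hc hM hn0 (optimisticV_mem_Icc hc hM n) s d (π 0 s d)).2.2
    have hmin : optimisticQ c δ h (optimisticV c δ h n) s d (π 0 s d) ≤
        optimisticV c δ h (n + 1) s d := by
      refine le_ciInf fun d' => ?_
      simpa using hπ 0 s d d'
    -- The tail of the policy is again optimistic, because `n + 1 - (t + 1 + 1) = n - (t + 1)`.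
    have hih := fun s' d' => ih (by linarith) (Fin.tail π) (fun t s d d' => by
      have := hπ t.succ s d d'
      rwa [Fin.val_succ, Nat.add_sub_add_right] at this) s' d'
    have h1 : expCost c M π s d ≤ (ev (M.agent (π 0 s d) s) fun a => ev (M.trans s a) fun s' =>
        c.env s a + c.ctrl (π 0 s d) + c.switch (π 0 s d) d + optimisticV c δ h n s' (π 0 s d)) +
        2 * H * ev (M.agent (π 0 s d) s) fun a => ev (M.trans s a) fun s' =>
          ev (rollout M (n := n) (Fin.tail π) s' (π 0 s d))
            (fun τ => ∑ t, (bD (τ t).1 (τ t).2.1 + bT (τ t).1 (τ t).2.2.1)) := by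
      rw [expCost_succ, ← ev_const_mul, ← ev_add]
      refine ev_mono _ fun a => ?_
      rw [← ev_const_mul, ← ev_add]
      exact ev_mono _ fun s' => by linarith [hih s' (π 0 s d)]
    -- The factor `n + 1` of this step is replaced by the common bound `H`, so that one prefactor
    -- serves the whole recursion.
    have h2 : 2 * ((n : ℝ) + 1) * (ev (M.agent (π 0 s d) s) fun a =>
        min 1 (radAgent δ h s (π 0 s d)) + min 1 (radTrans δ h s a)) ≤
        2 * H * ev (M.agent (π 0 s d) s) fun a => bD s (π 0 s d) + bT s a := by
      refine mul_le_mul (by linarith) (ev_mono _ fun a => add_le_add (hD _ _) (hT _ _))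
        (le_ev _ fun a => ?_) (by linarith)
      exact add_nonneg (le_min zero_le_one (Real.sqrt_nonneg _))
        (le_min zero_le_one (Real.sqrt_nonneg _))
    have h3 : ev (rollout M π s d)
        (fun τ => ∑ t, (bD (τ t).1 (τ t).2.1 + bT (τ t).1 (τ t).2.2.1)) =
        (ev (M.agent (π 0 s d) s) fun a => bD s (π 0 s d) + bT s a) +
        ev (M.agent (π 0 s d) s) fun a => ev (M.trans s a) fun s' =>
          ev (rollout M (n := n) (Fin.tail π) s' (π 0 s d))
            (fun τ => ∑ t, (bD (τ t).1 (τ t).2.1 + bT (τ t).1 (τ t).2.2.1)) := by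
      rw [ev_rollout_succ, ← ev_add]
      simp only [Fin.sum_univ_succ, Fin.cons_zero, Fin.cons_succ, ev_add, ev_const]
    rw [h3, mul_add]
    linarith

/-- Optimism replaces the unknown optimal cost by the computed value, so only the deployed policy
appears on the right. -/
theorem expCost_sub_optCost_le {bD : S → D → ℝ} {bT : S → A → ℝ}
    (hD : ∀ s d, min 1 (radAgent δ h s d) ≤ bD s d) (hT : ∀ s a, min 1 (radTrans δ h s a) ≤ bT s a)
    (π : Policy S D L) (hπ : IsOptimistic c δ h π) (s : S) (d : D) :
    expCost c M π s d - optCost c M L s d ≤ 2 * L * ev (rollout M π s d)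
      (fun τ => ∑ t, (bD (τ t).1 (τ t).2.1 + bT (τ t).1 (τ t).2.2.1)) := by
  have h1 := expCost_le_optimisticV_add hc hM hD hT le_rfl π hπ s d
  have h2 : optimisticV c δ h L s d ≤ optCost c M L s d := by
    have : Nonempty (Policy S D L) := ⟨π⟩
    exact le_ciInf fun π' => optimisticV_le_expCost hc hM π' s d
  linarith

end DynamicProgramming

/-! ### Sums of truncated radii when the counts are updated in batches. -/

section Bonus

/-- The truncated confidence radius after `n` observations. -/
def bonus (C : ℝ) (n : ℕ) : ℝ := min 1 √(C / max 1 (n : ℝ))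

theorem bonus_nonneg (C : ℝ) (n : ℕ) : 0 ≤ bonus C n := le_min zero_le_one (Real.sqrt_nonneg _)

theorem bonus_le_one (C : ℝ) (n : ℕ) : bonus C n ≤ 1 := min_le_left _ _

theorem bonus_eq_one {C : ℝ} (hC : 1 ≤ C) {n : ℕ} (hn : n ≤ 1) : bonus C n = 1 := by
  have : (n : ℝ) ≤ 1 := by exact_mod_cast hn
  rw [bonus, max_eq_left this, div_one, min_eq_left (Real.one_le_sqrt.2 hC)]

theorem min_one_sqrt_le_bonus {x C : ℝ} (h : x ≤ C) (n : ℕ) :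
    min 1 √(x / max 1 (n : ℝ)) ≤ bonus C n := by
  unfold bonus
  gcongr

/-- The sum of the truncated radii, if the counts are updated in batches of size at most `L`. -/
theorem sum_mul_bonus_le (C : ℝ) {L : ℕ} {n : ℕ → ℕ} (hn : ∀ k, n k ≤ L) (K : ℕ) :
    ∑ k ∈ Finset.range K, (n k : ℝ) * bonus C (∑ i ∈ Finset.range k, n i) ≤
      2 * L + 3 * √C * √((∑ i ∈ Finset.range K, n i : ℕ) : ℝ) := by
  -- The term `min N (2 * L)` is a potential that pays for the batches arriving while the count is
  -- still below `L`.
  suffices h : ∑ k ∈ Finset.range K, (n k : ℝ) * bonus C (∑ i ∈ Finset.range k, n i) ≤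
      min ((∑ i ∈ Finset.range K, n i : ℕ) : ℝ) (2 * L) +
        3 * √C * √((∑ i ∈ Finset.range K, n i : ℕ) : ℝ) from
    h.trans (add_le_add_left (min_le_right _ _) _)
  induction K with
  | zero => simp
  | succ K ih =>
    rw [Finset.sum_range_succ, Finset.sum_range_succ _ K]
    generalize ∑ i ∈ Finset.range K, n i = N at ih ⊢
    have hx : (n K : ℝ) ≤ L := by exact_mod_cast hn K
    have hx0 : (0 : ℝ) ≤ n K := Nat.cast_nonneg _
    have hN0 : (0 : ℝ) ≤ N := Nat.cast_nonneg _
    push_cast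
    generalize (n K : ℝ) = x at *
    refine (add_le_add_left ih _).trans ?_
    -- Below `L` the potential grows by the full batch and the bonus is at most one. From `L` on, a
    -- batch at most doubles the count, and the square root pays.
    rcases lt_or_ge (N : ℝ) L with hNL | hNL
    · rw [min_eq_left (by linarith), min_eq_left (by linarith)]
      have h1 : x * bonus C N ≤ x := mul_le_of_le_one_right hx0 (bonus_le_one _ _)
      have h2 : 3 * √C * √(N : ℝ) ≤ 3 * √C * √((N : ℝ) + x) := by gcongr; linarith
      linarith
    · have h1 : min (N : ℝ) (2 * L) ≤ min ((N : ℝ) + x) (2 * L) :=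
        min_le_min_right _ (by linarith)
      have h2 : x * bonus C N ≤ 3 * √C * (√((N : ℝ) + x) - √(N : ℝ)) := by
        rcases hx0.eq_or_lt with rfl | hxpos
        · simp
        have hNpos : (0 : ℝ) < N := by linarith
        have hb : bonus C N ≤ √C / √(N : ℝ) := by
          refine (min_le_right _ _).trans ?_
          have : (1 : ℝ) ≤ N := by exact_mod_cast Nat.pos_of_ne_zero (by rintro rfl; simp at hNpos)
          rw [max_eq_right this, Real.sqrt_div' _ hN0]
        have hr : 0 < √(N : ℝ) := Real.sqrt_pos.2 hNpos
        -- Write `x = (√(N + x) - √N) * (√(N + x) + √N)`; the last factor is at most `3 * √N`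
        -- because `x ≤ L ≤ N`.
        have hd : x / √(N : ℝ) ≤ 3 * (√((N : ℝ) + x) - √(N : ℝ)) := by
          rw [div_le_iff₀ hr]
          have e1 := Real.sq_sqrt hN0
          have e2 := Real.sq_sqrt (add_nonneg hN0 hx0)
          have e3 : √((N : ℝ) + x) ≤ 2 * √(N : ℝ) := by
            rw [Real.sqrt_le_left (by positivity), mul_pow, e1]
            linarith
          have e4 : √(N : ℝ) ≤ √((N : ℝ) + x) := Real.sqrt_le_sqrt (by linarith)
          nlinarith
        calc x * bonus C N ≤ x * (√C / √(N : ℝ)) := mul_le_mul_of_nonneg_left hb hx0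
          _ = √C * (x / √(N : ℝ)) := by ring
          _ ≤ √C * (3 * (√((N : ℝ) + x) - √(N : ℝ))) :=
              mul_le_mul_of_nonneg_left hd (Real.sqrt_nonneg _)
          _ = _ := by ring
      linarith

variable {S : Type u} {A : Type v} {D : Type w} {L K : ℕ}

/-- The number of steps of an episode which satisfy `P`. -/
def episodeCnt (P : Step S A D → Prop) [DecidablePred P] (h : History S A D L K) (k : ℕ) : ℕ :=
  if hk : k < K then ∑ t, if P ((h ⟨k, hk⟩).2 t) then 1 else 0 else 0

theorem episodeCnt_le (P : Step S A D → Prop) [DecidablePred P] (h : History S A D L K) (k : ℕ) :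
    episodeCnt P h k ≤ L := by
  unfold episodeCnt
  split_ifs with hk
  · exact (Finset.sum_le_sum fun t _ => by split_ifs <;> simp).trans_eq
      (show ∑ _t : Fin L, 1 = L by simp)
  · exact Nat.zero_le _

theorem cnt_before (P : Step S A D → Prop) [DecidablePred P] (h : History S A D L K) (k : Fin K) :
    cnt P (before h k) = ∑ i ∈ Finset.range k, episodeCnt P h i := by
  rw [Finset.sum_range]
  refine Finset.sum_congr rfl fun i _ => ?_
  rw [episodeCnt, dif_pos (i.2.trans k.2)]
  rfl

theorem cnt_eq_sum_range (P : Step S A D → Prop) [DecidablePred P] (h : History S A D L K) :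
    cnt P h = ∑ i ∈ Finset.range K, episodeCnt P h i := by
  rw [Finset.sum_range]
  refine Finset.sum_congr rfl fun i _ => ?_
  rw [episodeCnt, dif_pos i.2]

/-- The sum of the truncated radii along the data is of the order of the square root of the number
of steps. -/
theorem sum_sum_bonus_le {κ : Type*} [Fintype κ] [DecidableEq κ] (key : Step S A D → κ) (C : ℝ)
    (h : History S A D L K) :
    ∑ k : Fin K, ∑ t : Fin L,
        bonus C (cnt (fun x => key x = key ((h k).2 t)) (before h k)) ≤
      2 * L * Fintype.card κ + 3 * (√C * √(Fintype.card κ * (K * L))) := by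
  -- The counts are frozen during an episode, so all its steps with the same key carry the same
  -- bonus.
  have h1 : ∀ k : Fin K, ∑ t : Fin L,
      bonus C (cnt (fun x => key x = key ((h k).2 t)) (before h k)) =
      ∑ y : κ, (episodeCnt (fun x => key x = y) h k : ℝ) *
        bonus C (∑ i ∈ Finset.range k, episodeCnt (fun x => key x = y) h i) := by
    intro k
    simp only [← cnt_before]
    simp only [episodeCnt, k.2, dif_pos, Nat.cast_sum, Finset.sum_mul]
    rw [Finset.sum_comm]
    refine Finset.sum_congr rfl fun t _ => ?_
    rw [Finset.sum_eq_single (key ((h k).2 t))]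
    · simp
    · intro b _ hb
      simp [hb.symm]
    · simp
  simp only [h1]
  rw [Finset.sum_comm]
  have hN : ∑ y : κ, (cnt (fun x => key x = y) h : ℝ) ≤ K * L := by
    have := sum_cnt_and (fun _ => True) key Finset.univ h
    simp only [true_and] at this
    rw [← Nat.cast_sum, this]
    exact_mod_cast cnt_le _ h
  -- Cauchy–Schwarz over the keys.
  have hs : ∑ y : κ, √(cnt (fun x => key x = y) h : ℝ) ≤ √(Fintype.card κ * (K * L)) := by
    refine Real.le_sqrt_of_sq_le ((sq_sum_le_card_mul_sum_sq).trans ?_)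
    simp only [Real.sq_sqrt (Nat.cast_nonneg _), Finset.card_univ]
    exact mul_le_mul_of_nonneg_left hN (Nat.cast_nonneg _)
  calc _ ≤ ∑ y : κ, (2 * L + 3 * √C * √(cnt (fun x => key x = y) h : ℝ)) := by
        refine Finset.sum_le_sum fun y _ => ?_
        rw [cnt_eq_sum_range, ← Finset.sum_range fun k =>
          (episodeCnt (fun x => key x = y) h k : ℝ) *
            bonus C (∑ i ∈ Finset.range k, episodeCnt (fun x => key x = y) h i)]
        exact sum_mul_bonus_le C (episodeCnt_le _ h) K
    _ = 2 * L * Fintype.card κ + 3 * (√C * ∑ y : κ, √(cnt (fun x => key x = y) h : ℝ)) := by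
        rw [Finset.sum_add_distrib, ← Finset.mul_sum _ _ (3 * √C), Finset.sum_const, Finset.card_univ,
          nsmul_eq_mul]
        ring
    _ ≤ _ := by gcongr

end Bonus

/-! ### The two likely events: plausible confidence sets, and expected radii controlled by realized
ones. -/

section GoodEvent

/-- Outside the deviation set, the true law lies in the `L¹` ball around the empirical law. -/
theorem sum_abs_sub_empirical_le {S : Type u} {A : Type v} {D : Type w} {L j : ℕ} {Ω : Type*} [Fintype Ω] [DecidableEq Ω]
    {P : Step S A D → Prop} [DecidablePred P] {o : Step S A D → Ω} {p : PMF Ω} {X : ℝ}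
    (hX : 2 ≤ Real.log X) {h : History S A D L j} (hh : h ∉ deviationSet L j P o p X) :
    ∑ y, |(p y).toReal - if cnt P h ≠ 0 then
      (cnt (fun x => P x ∧ o x = y) h : ℝ) / (cnt P h : ℝ) else 1 / (Fintype.card Ω : ℝ)| ≤
      √(2 * Real.log X / max 1 (cnt P h : ℝ)) := by
  by_cases hn : cnt P h = 0
  -- Without observations the empirical law is uniform and at distance at most two; `hX` makes the
  -- radius at least two.
  · simp only [hn, ne_eq, not_true_eq_false, if_false, Nat.cast_zero]
    rw [max_eq_left zero_le_one, div_one]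
    have hΩ : (0 : ℝ) < Fintype.card Ω := by
      obtain ⟨y, -⟩ := p.support_nonempty
      have : Nonempty Ω := ⟨y⟩
      exact_mod_cast Fintype.card_pos
    calc _ ≤ ∑ y, ((p y).toReal + 1 / (Fintype.card Ω : ℝ)) := by
          refine Finset.sum_le_sum fun y _ => ?_
          have h1 : 0 ≤ (p y).toReal := ENNReal.toReal_nonneg
          have h2 : 0 ≤ 1 / (Fintype.card Ω : ℝ) := by positivity
          rw [abs_le]
          constructor <;> linarith
      _ = 2 := by
          rw [Finset.sum_add_distrib, sum_toReal_eq_one, Finset.sum_const, Finset.card_univ, nsmul_eq_mul,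
            mul_one_div_cancel hΩ.ne']
          norm_num
      _ ≤ _ := Real.le_sqrt_of_sq_le (by linarith)
  · have h1 : (1 : ℝ) ≤ cnt P h := by exact_mod_cast Nat.pos_of_ne_zero hn
    rw [max_eq_right h1]
    simp only [ne_eq, hn, not_false_eq_true, if_true]
    by_contra hlt
    refine hh ⟨hn, (not_le.1 hlt).trans_eq ?_⟩
    exact Finset.sum_congr rfl fun y _ => abs_sub_comm _ _

variable {S : Type u} {A : Type v} {D : Type w} [Fintype S] [Fintype A] [Fintype D]
variable {L : ℕ} (M : Dynamics S A D) (init : ∀ j, History S A D L j → PMF (S × D))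
  (alg : ∀ j, History S A D L j → Policy S D L)

/-- A bound linear in `x`, so that its expectation involves only the mean. It holds since `(1 - x /
2) * (1 + x + x ^ 2 / 2) = 1 + x / 2 - x ^ 3 / 4 ≥ 1`. -/
theorem exp_neg_le_one_sub_half {x : ℝ} (h0 : 0 ≤ x) (h1 : x ≤ 1) :
    Real.exp (-x) ≤ 1 - x / 2 := by
  rw [Real.exp_neg]
  refine inv_le_of_inv_le₀ (by linarith) ?_
  refine le_trans ?_ (Real.quadratic_le_exp_of_nonneg h0)
  rw [inv_le_iff_one_le_mul₀ (by linarith)]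
  nlinarith [mul_nonneg h0 (sub_nonneg.2 h1), mul_nonneg h0 h0]

/-- With high probability, the sum of the conditional expectations of non-negative bounded
functions of the episodes is at most of the order of the sum of their values. -/
theorem ev_sum_ev_gt_le {G : ∀ j, History S A D L j → Traj S A D L → ℝ} {R : ℝ} (hR : 0 < R)
    (hG : ∀ j h τ, 0 ≤ G j h τ ∧ G j h τ ≤ R) {ε : ℝ} (hε : 0 < ε) (K : ℕ) :
    ev (interaction M init alg K) ({h : History S A D L K |
      2 * ∑ k : Fin K, G k (before h k) (h k).2 + 2 * R * Real.log ε⁻¹ <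
        ∑ k : Fin K, ev (rollout M (alg k (before h k)) (h k).1.1 (h k).1.2)
          (G k (before h k))}.indicator 1) ≤ ε := by
  -- The mean enters with half the weight of the value. This slack absorbs the second-order term of
  -- the exponential, so no variance term appears.
  let W : ∀ j, History S A D L j → Episode S A D L → ℝ := fun j h e =>
    Real.exp (ev (rollout M (alg j h) e.1.1 e.1.2) (G j h) / (2 * R) - G j h e.2 / R)
  have hW := ev_interaction_prod_le_one M init alg W (fun _ _ _ => (Real.exp_pos _).le)
    (fun j h x => by
      set m := ev (rollout M (alg j h) x.1 x.2) (G j h) with hm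
      have hx : ∀ τ, W j h (x, τ) ≤ Real.exp (m / (2 * R)) * (1 + -(1 / (2 * R)) * G j h τ) := by
        intro τ
        have := exp_neg_le_one_sub_half (div_nonneg (hG j h τ).1 hR.le)
          ((div_le_one hR).2 (hG j h τ).2)
        calc W j h (x, τ) = Real.exp (m / (2 * R)) * Real.exp (-(G j h τ / R)) := by
              rw [← Real.exp_add, ← sub_eq_add_neg]
          _ ≤ Real.exp (m / (2 * R)) * (1 - G j h τ / R / 2) :=
              mul_le_mul_of_nonneg_left this (Real.exp_pos _).le
          _ = _ := by field_simp; ring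
      refine (ev_mono _ hx).trans ?_
      rw [ev_const_mul, ev_add, ev_const, ev_const_mul, ← hm]
      have h2 : 1 + -(1 / (2 * R)) * m ≤ Real.exp (-(m / (2 * R))) := by
        refine le_trans (le_of_eq ?_) (Real.add_one_le_exp _)
        ring
      refine (mul_le_mul_of_nonneg_left h2 (Real.exp_pos _).le).trans_eq ?_
      rw [← Real.exp_add, add_neg_cancel, Real.exp_zero]) K
  -- Markov's inequality: on the bad event the product of the weights is at least `ε⁻¹`.
  refine (ev_mono _ fun h => ?_).trans ((ev_const_mul _ ε _).trans_le
    (mul_le_of_le_one_right hε.le hW))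
  have hpos : 0 ≤ ε * ∏ k : Fin K, W k (before h k) (h k) :=
    mul_nonneg hε.le (Finset.prod_nonneg fun _ _ => (Real.exp_pos _).le)
  by_cases hh : h ∈ {h : History S A D L K |
      2 * ∑ k : Fin K, G k (before h k) (h k).2 + 2 * R * Real.log ε⁻¹ <
        ∑ k : Fin K, ev (rollout M (alg k (before h k)) (h k).1.1 (h k).1.2) (G k (before h k))}
  · rw [Set.indicator_of_mem hh, Pi.one_apply]
    rw [Set.mem_ofPred_eq] at hh
    rw [← div_le_iff₀' hε, one_div]
    simp only [W, ← Real.exp_sum, Finset.sum_sub_distrib, ← Finset.sum_div]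
    rw [← Real.exp_log (inv_pos.2 hε), Real.exp_le_exp, le_sub_iff_add_le,
      le_div_iff₀ (by positivity)]
    refine (le_of_eq ?_).trans hh.le
    field_simp
    ring
  · rw [Set.indicator_of_notMem hh]
    exact hpos

variable [DecidableEq S] [DecidableEq A] [DecidableEq D]

theorem agent_mem_confAgent {j : ℕ} {δ : ℝ} {h : History S A D L j} {s : S} {d : D} {X : ℝ}
    (hXe : X = (j : ℝ) ^ 7 * (L : ℝ) ^ 7 * (Fintype.card S : ℝ) * (Fintype.card D : ℝ) *
      2 ^ (Fintype.card A + 1) / δ) (hX : 2 ≤ Real.log X)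
    (hh : h ∉ deviationSet L j (fun x => x.1 = s ∧ x.2.1 = d) (fun x => x.2.2.1)
      (M.agent d s) X) :
    (fun a => (M.agent d s a).toReal) ∈ confAgent δ h s d := by
  refine ⟨toReal_mem_stdSimplex _, ?_⟩
  have := sum_abs_sub_empirical_le hX hh
  have e : ∀ a, cnt (fun x => (x.1 = s ∧ x.2.1 = d) ∧ x.2.2.1 = a) h = cntSDA h s d a := fun a => by
    simp only [cnt, cntSDA, and_assoc]
  simp only [e] at this
  subst hXe
  exact this

theorem trans_mem_confTrans {j : ℕ} {δ : ℝ} {h : History S A D L j} {s : S} {a : A} {X : ℝ}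
    (hXe : X = (j : ℝ) ^ 7 * (L : ℝ) ^ 7 * (Fintype.card S : ℝ) * (Fintype.card A : ℝ) *
      2 ^ (Fintype.card S + 1) / δ) (hX : 2 ≤ Real.log X)
    (hh : h ∉ deviationSet L j (fun x => x.1 = s ∧ x.2.2.1 = a) (fun x => x.2.2.2)
      (M.trans s a) X) :
    (fun s' => (M.trans s a s').toReal) ∈ confTrans δ h s a := by
  refine ⟨toReal_mem_stdSimplex _, ?_⟩
  have := sum_abs_sub_empirical_le hX hh
  have e : ∀ s', cnt (fun x => (x.1 = s ∧ x.2.2.1 = a) ∧ x.2.2.2 = s') h = cntSAS h s a s' := fun s' => by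
    simp only [cnt, cntSAS, and_assoc]
  simp only [e] at this
  subst hXe
  exact this

theorem two_le_log_of_two_pow_le {X : ℝ} (hX : 2 ^ 7 ≤ X) : 2 ≤ Real.log X := by
  have h1 := Real.log_le_log (by norm_num) hX
  rw [Real.log_pow] at h1
  have := Real.log_two_gt_d9
  push_cast at h1
  linarith

/-- With at least two steps of data the factor `(j * L) ^ 7` alone makes the logarithm at least two,
as the case of an unvisited pair requires. -/
theorem two_pow_le_confidence {j L a b n : ℕ} {δ : ℝ} (hjL : 2 ≤ j * L) (ha : 1 ≤ a) (hb : 1 ≤ b)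
    (hδ : 0 < δ) (hδ1 : δ < 1) :
    2 ^ 7 ≤ (j : ℝ) ^ 7 * (L : ℝ) ^ 7 * (a : ℝ) * (b : ℝ) * 2 ^ n / δ := by
  have h1 : (2 : ℝ) ≤ (j : ℝ) * L := by exact_mod_cast hjL
  have ha' : (1 : ℝ) ≤ a := by exact_mod_cast ha
  have hb' : (1 : ℝ) ≤ b := by exact_mod_cast hb
  rw [← mul_pow, le_div_iff₀ hδ]
  calc (2 : ℝ) ^ 7 * δ ≤ 2 ^ 7 * 1 * 1 * 1 := by linarith
    _ ≤ ((j : ℝ) * L) ^ 7 * a * b * 2 ^ n := by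
        gcongr
        exact one_le_pow₀ (by norm_num)

/-- After `j` episodes, the probability that the confidence sets miss the true laws. -/
theorem ev_not_isPlausible_le {j : ℕ} (hjL : 2 ≤ j * L) {δ : ℝ} (hδ : 0 < δ) (hδ1 : δ < 1)
    (hS : 1 ≤ Fintype.card S) (hA : 1 ≤ Fintype.card A) (hD : 1 ≤ Fintype.card D) :
    ev (interaction M init alg j) ({h | ¬ IsPlausible M δ h}.indicator 1) ≤
      δ / ((j : ℝ) * L) ^ 6 := by
  obtain ⟨X₁, hX₁⟩ : ∃ X, X = (j : ℝ) ^ 7 * (L : ℝ) ^ 7 * (Fintype.card S : ℝ) *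
    (Fintype.card D : ℝ) * 2 ^ (Fintype.card A + 1) / δ := ⟨_, rfl⟩
  obtain ⟨X₂, hX₂⟩ : ∃ X, X = (j : ℝ) ^ 7 * (L : ℝ) ^ 7 * (Fintype.card S : ℝ) *
    (Fintype.card A : ℝ) * 2 ^ (Fintype.card S + 1) / δ := ⟨_, rfl⟩
  have hb₁ : 2 ^ 7 ≤ X₁ := hX₁ ▸ two_pow_le_confidence hjL hS hD hδ hδ1
  have hb₂ : 2 ^ 7 ≤ X₂ := hX₂ ▸ two_pow_le_confidence hjL hS hA hδ hδ1
  have hpt : ∀ h : History S A D L j, ({h | ¬ IsPlausible M δ h}.indicator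
      (1 : History S A D L j → ℝ)) h ≤
      (∑ x : S × D, (deviationSet L j (fun y => y.1 = x.1 ∧ y.2.1 = x.2) (fun y => y.2.2.1)
        (M.agent x.2 x.1) X₁).indicator (1 : History S A D L j → ℝ) h) +
      ∑ x : S × A, (deviationSet L j (fun y => y.1 = x.1 ∧ y.2.2.1 = x.2) (fun y => y.2.2.2)
        (M.trans x.1 x.2) X₂).indicator (1 : History S A D L j → ℝ) h := by
    intro h
    have hi : ∀ E : Set (History S A D L j), 0 ≤ E.indicator (1 : History S A D L j → ℝ) h :=
      fun E => Set.indicator_nonneg (by simp) h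
    by_cases hh : IsPlausible M δ h
    · rw [Set.indicator_of_notMem (by simpa using hh)]
      exact add_nonneg (Finset.sum_nonneg fun _ _ => hi _) (Finset.sum_nonneg fun _ _ => hi _)
    · rw [Set.indicator_of_mem (by exact hh), Pi.one_apply]
      rw [IsPlausible, not_and_or] at hh
      push Not at hh
      rcases hh with ⟨s, d, hsd⟩ | ⟨s, a, hsa⟩
      · refine le_add_of_le_of_nonneg ?_ (Finset.sum_nonneg fun _ _ => hi _)
        refine le_trans ?_ (Finset.single_le_sum (fun x _ => hi _) (Finset.mem_univ (s, d)))
        rw [Set.indicator_of_mem, Pi.one_apply]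
        by_contra hm
        exact hsd (agent_mem_confAgent M hX₁ (two_le_log_of_two_pow_le hb₁) hm)
      · refine le_add_of_nonneg_of_le (Finset.sum_nonneg fun _ _ => hi _) ?_
        refine le_trans ?_ (Finset.single_le_sum (fun x _ => hi _) (Finset.mem_univ (s, a)))
        rw [Set.indicator_of_mem, Pi.one_apply]
        by_contra hm
        exact hsa (trans_mem_confTrans M hX₂ (two_le_log_of_two_pow_le hb₂) hm)
  refine (ev_mono _ hpt).trans ?_
  rw [ev_add, ev_sum, ev_sum]
  have hone₁ : 1 ≤ X₁ := le_trans (by norm_num) hb₁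
  have hone₂ : 1 ≤ X₂ := le_trans (by norm_num) hb₂
  -- The factors `j * L * 2 ^ card Ω` and the number of pairs cancel against `X₁` and `X₂`; the
  -- extra factor two in each leaves `δ / (2 * (j * L) ^ 6)` per family.
  refine (add_le_add (Finset.sum_le_sum fun x _ =>
      ev_deviationSet_le M init alg (isSampling_agent M x.1 x.2) hone₁)
    (Finset.sum_le_sum fun x _ =>
      ev_deviationSet_le M init alg (isSampling_trans M x.1 x.2) hone₂)).trans_eq ?_
  have hj0 : (j : ℝ) ≠ 0 := by rintro h0; simp_all
  have hL0 : (L : ℝ) ≠ 0 := by rintro h0; simp_all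
  have hS0 : (Fintype.card S : ℝ) ≠ 0 := by exact_mod_cast (by omega)
  have hA0 : (Fintype.card A : ℝ) ≠ 0 := by exact_mod_cast (by omega)
  have hD0 : (Fintype.card D : ℝ) ≠ 0 := by exact_mod_cast (by omega)
  rw [Finset.sum_const, Finset.sum_const, Finset.card_univ, Finset.card_univ, Fintype.card_prod,
    Fintype.card_prod, nsmul_eq_mul, nsmul_eq_mul, hX₁, hX₂]
  push_cast
  rw [pow_succ (2 : ℝ) (Fintype.card A), pow_succ (2 : ℝ) (Fintype.card S)]
  field_simp
  ring

/-- The case `k * L = 1` is left out because it would contribute one by itself, more than the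
available failure probability. -/
theorem sum_range_inv_pow_le {L : ℕ} (K : ℕ) :
    ∑ k ∈ Finset.range K, (if 2 ≤ k * L then 1 / ((k : ℝ) * L) ^ 6 else 0) ≤ 1 / 2 := by
  -- Each term is at most `1 / (2 * (k + 1) * (k + 2))`, which telescopes.
  suffices h : ∑ k ∈ Finset.range K, (if 2 ≤ k * L then 1 / ((k : ℝ) * L) ^ 6 else 0) ≤
      1 / 2 - 1 / (2 * (K : ℝ) + 2) from h.trans (sub_le_self _ (by positivity))
  induction K with
  | zero => norm_num
  | succ K ih =>
    rw [Finset.sum_range_succ]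
    have hstep : (if 2 ≤ K * L then 1 / ((K : ℝ) * L) ^ 6 else 0) ≤
        1 / (2 * (K : ℝ) + 2) - 1 / (2 * ((K : ℝ) + 1) + 2) := by
      have he : 1 / (2 * (K : ℝ) + 2) - 1 / (2 * ((K : ℝ) + 1) + 2) =
          1 / (2 * ((K : ℝ) + 1) * (K + 2)) := by field_simp; ring
      rw [he]
      split_ifs with h2
      · have hL : 1 ≤ L := Nat.pos_of_ne_zero (by rintro rfl; simp at h2)
        have hK : 1 ≤ K := Nat.pos_of_ne_zero (by rintro rfl; simp at h2)
        have h2' : (2 : ℝ) ≤ (K : ℝ) * L := by exact_mod_cast h2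
        have hL' : (1 : ℝ) ≤ L := by exact_mod_cast hL
        have hK' : (1 : ℝ) ≤ K := by exact_mod_cast hK
        have hKL : (K : ℝ) ≤ K * L := le_mul_of_one_le_right (by linarith) hL'
        refine one_div_le_one_div_of_le (by positivity) ?_
        calc 2 * ((K : ℝ) + 1) * (K + 2) ≤ 2 ^ 4 * (K : ℝ) ^ 2 := by nlinarith
          _ ≤ ((K : ℝ) * L) ^ 4 * ((K : ℝ) * L) ^ 2 := by gcongr
          _ = _ := by ring
      · positivity
    push_cast
    linarith

/-- With high probability, all confidence sets contain the true laws, except perhaps those which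
are based on at most one step. -/
theorem ev_exists_not_isPlausible_le {δ : ℝ} (hδ : 0 < δ) (hδ1 : δ < 1)
    (hS : 1 ≤ Fintype.card S) (hA : 1 ≤ Fintype.card A) (hD : 1 ≤ Fintype.card D) (K : ℕ) :
    ev (interaction M init alg K) ({h : History S A D L K | ∃ k : Fin K, 2 ≤ (k : ℕ) * L ∧
      ¬ IsPlausible M δ (before h k)}.indicator 1) ≤ δ / 2 := by
  have hpt : ∀ h : History S A D L K, ({h : History S A D L K | ∃ k : Fin K, 2 ≤ (k : ℕ) * L ∧
      ¬ IsPlausible M δ (before h k)}.indicator (1 : History S A D L K → ℝ)) h ≤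
      ∑ k : Fin K, (if 2 ≤ (k : ℕ) * L then 1 else 0) * ({h : History S A D L k |
        ¬ IsPlausible M δ h}.indicator (1 : History S A D L k → ℝ)) (before h k) := by
    intro h
    have hi : ∀ k : Fin K, 0 ≤ (if 2 ≤ (k : ℕ) * L then (1 : ℝ) else 0) *
        ({h : History S A D L k | ¬ IsPlausible M δ h}.indicator
          (1 : History S A D L k → ℝ)) (before h k) := fun k =>
      mul_nonneg (by split_ifs <;> simp) (Set.indicator_nonneg (by simp) _)
    by_cases hh : ∃ k : Fin K, 2 ≤ (k : ℕ) * L ∧ ¬ IsPlausible M δ (before h k)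
    · rw [Set.indicator_of_mem (by exact hh), Pi.one_apply]
      obtain ⟨k, hk, hk'⟩ := hh
      refine le_trans ?_ (Finset.single_le_sum (fun k _ => hi k) (Finset.mem_univ k))
      rw [if_pos hk, Set.indicator_of_mem (by exact hk')]
      simp
    · rw [Set.indicator_of_notMem (by exact hh)]
      exact Finset.sum_nonneg fun k _ => hi k
  refine (ev_mono _ hpt).trans ?_
  rw [ev_sum]
  calc _ ≤ ∑ k : Fin K, δ * (if 2 ≤ (k : ℕ) * L then 1 / ((k : ℝ) * L) ^ 6 else 0) := by
        refine Finset.sum_le_sum fun k _ => ?_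
        rw [ev_const_mul, ev_interaction_before]
        split_ifs with hk
        · rw [one_mul, mul_one_div]
          exact ev_not_isPlausible_le M init alg hk hδ hδ1 hS hA hD
        · simp
    _ ≤ δ * (1 / 2) := by
        rw [← Finset.mul_sum, ← Finset.sum_range fun k : ℕ =>
          if 2 ≤ k * L then 1 / ((k : ℝ) * L) ^ 6 else 0]
        exact mul_le_mul_of_nonneg_left (sum_range_inv_pow_le K) hδ.le
    _ = δ / 2 := by ring

end GoodEvent

/-! ### Absorbing logarithms and lower-order terms into the bound. -/

section Numeric

/-- With `l = log (m * T / δ) ≥ log 2`, the left side is at most `2 * (7 * l + (a + 1) * l) = 2 * (a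
+ 8) * l`, and `a + 8 ≤ 9 * a`. -/
theorem two_mul_log_confidence_le {T m δ : ℝ} {a : ℕ} (hT : 1 ≤ T) (hm : 1 ≤ m) (ha : 1 ≤ a)
    (hδ : 0 < δ) (hδ1 : δ < 1) (h2 : 2 ≤ m * T) :
    2 * Real.log (T ^ 7 * m * 2 ^ (a + 1) / δ) ≤ 18 * (a * Real.log (m * T / δ)) := by
  have hx2 : 2 ≤ m * T / δ := h2.trans (le_div_self (by linarith) hδ hδ1.le)
  have hl : Real.log 2 ≤ Real.log (m * T / δ) := Real.log_le_log two_pos hx2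
  have hl0 := Real.log_pos one_lt_two
  have ha' : (1 : ℝ) ≤ a := by exact_mod_cast ha
  have hX : T ^ 7 * m * 2 ^ (a + 1) / δ ≤ (m * T / δ) ^ 7 * 2 ^ (a + 1) := by
    have h1 : m ≤ m ^ 7 := le_self_pow₀ hm (by norm_num)
    have h3 : δ ^ 7 ≤ δ := pow_le_of_le_one hδ.le hδ1.le (by norm_num)
    calc T ^ 7 * m * 2 ^ (a + 1) / δ ≤ T ^ 7 * m ^ 7 * 2 ^ (a + 1) / δ ^ 7 := by gcongr
      _ = _ := by rw [div_pow, mul_pow]; ring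
  have h := Real.log_le_log (by positivity) hX
  rw [Real.log_mul (by positivity) (by positivity), Real.log_pow, Real.log_pow] at h
  push_cast at h
  generalize Real.log (m * T / δ) = l at *
  nlinarith [mul_le_mul_of_nonneg_left hl (by linarith : (0 : ℝ) ≤ (a : ℝ) + 1),
    mul_le_mul_of_nonneg_right ha' (hl0.le.trans hl)]

theorem sqrt_mul_sqrt_le_five_mul {C m y z : ℝ} (hm : 0 ≤ m) (hy : 0 ≤ y) (hC : C ≤ 18 * y)
    (hz : y * m = z) : √C * √m ≤ 5 * √z := by
  rw [← Real.sqrt_mul' _ hm]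
  calc √(C * m) ≤ √(5 ^ 2 * z) := by
        refine Real.sqrt_le_sqrt ?_
        have h0 := mul_nonneg hy hm
        have h1 := mul_le_mul_of_nonneg_right hC hm
        nlinarith
    _ = 5 * √z := by rw [Real.sqrt_mul (by norm_num), Real.sqrt_sq (by norm_num)]

theorem le_regretBound {R L T δ C₁ C₂ : ℝ} {nS nA nD l : ℕ} (hl : (l : ℝ) = L) (hL : 1 ≤ L)
    (hS : 1 ≤ nS) (hA : 1 ≤ nA) (hD : 2 ≤ nD) (hT : 1 ≤ T) (hδ : 0 < δ) (hδ1 : δ < 1)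
    (hRT : R ≤ T)
    (hC₁ : C₁ ≤ 18 * (nA * Real.log (nS * nD * T / δ)))
    (hC₂ : 2 ≤ T → C₂ ≤ 18 * (nS * Real.log (nS * nA * T / δ)))
    (hR : R ≤ 2 * L * (2 * ((2 * L * (nS * nD) + 3 * (√C₁ * √(nS * nD * T))) +
      (2 * L * (nS * nA) + 3 * (√C₂ * √(nS * nA * T)))) +
      2 * (2 * L) * Real.log (δ / 2)⁻¹)) :
    R ≤ regretBound 100 60 nS nA nD l T δ := by
  have hS' : (1 : ℝ) ≤ nS := by exact_mod_cast hS
  have hA' : (1 : ℝ) ≤ nA := by exact_mod_cast hA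
  have hD' : (2 : ℝ) ≤ nD := by exact_mod_cast hD
  have hm : 2 ≤ (nS : ℝ) * nD * T := by
    calc (2 : ℝ) = 1 * 2 * 1 := by norm_num
      _ ≤ nS * nD * T := by gcongr
  obtain ⟨ℓ₁, hℓ₁⟩ : ∃ x, x = Real.log (nS * nD * T / δ) := ⟨_, rfl⟩
  obtain ⟨ℓ₂, hℓ₂⟩ : ∃ x, x = Real.log (nS * nA * T / δ) := ⟨_, rfl⟩
  have h2δ : Real.log (δ / 2)⁻¹ ≤ ℓ₁ := by
    rw [hℓ₁, inv_div]
    exact Real.log_le_log (by positivity) (by gcongr)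
  have hhalf : 1 / 2 ≤ ℓ₁ := by
    have h1 : Real.log 2 ≤ Real.log (δ / 2)⁻¹ := by
      refine Real.log_le_log two_pos ?_
      rw [inv_div, le_div_iff₀ hδ]
      linarith
    have := Real.log_two_gt_d9
    linarith
  unfold regretBound
  rw [← hℓ₁] at hC₁ ⊢
  rw [← hℓ₂] at hC₂ ⊢
  rw [hl]
  set Y : ℝ := nA * nS * nD with hY
  have hY0 : 1 ≤ Y := by
    calc (1 : ℝ) = 1 * 1 * 1 := by norm_num
      _ ≤ nA * nS * nD := by gcongr; linarith
  have hB₂ : 0 ≤ L * nS * √(nA * T * ℓ₂) := by positivity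
  have hB₁ : 0 ≤ L * √(Y * T * ℓ₁) := by positivity
  rcases le_or_gt T (4 * L ^ 2 * Y * ℓ₁) with hsmall | hlarge
  -- For small `T` the trivial bound `R ≤ T` suffices, since `T` is the geometric mean of itself and
  -- `T`.
  · have h1 : T ≤ 2 * L * √(Y * T * ℓ₁) := by
      calc T = √(T * T) := (Real.sqrt_mul_self (by linarith)).symm
        _ ≤ √((2 * L) ^ 2 * (Y * T * ℓ₁)) := by
            refine Real.sqrt_le_sqrt ?_
            have := mul_le_mul_of_nonneg_right hsmall (by linarith : 0 ≤ T)
            linarith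
        _ = 2 * L * √(Y * T * ℓ₁) := by
            rw [Real.sqrt_mul (by positivity), Real.sqrt_sq (by positivity)]
    linarith
  -- Large `T` also gives access to `hC₂`: with a single state and action, its logarithm at `T = 1`
  -- would be only `log (1 / δ)`.
  · have hT2 : 2 ≤ T := by
      have : 1 * 1 * (1 / 2) ≤ L ^ 2 * Y * ℓ₁ := by gcongr; exact one_le_pow₀ hL
      linarith
    have hℓ₂0 : 0 ≤ ℓ₂ := by
      rw [hℓ₂]
      refine Real.log_nonneg ?_
      rw [le_div_iff₀ hδ]
      calc 1 * δ ≤ 1 * 1 * 1 := by linarith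
        _ ≤ nS * nA * T := by gcongr
    have hroot : 2 * L * Y * ℓ₁ ≤ √(Y * T * ℓ₁) := by
      refine Real.le_sqrt_of_sq_le ?_
      have := mul_le_mul_of_nonneg_left hlarge.le (by positivity : 0 ≤ Y * ℓ₁)
      linarith
    have hbase : L ^ 2 * (2 * Y * ℓ₁) ≤ L * √(Y * T * ℓ₁) := by
      have := mul_le_mul_of_nonneg_left hroot (by linarith : 0 ≤ L)
      linarith
    have hYl : Y ≤ 2 * Y * ℓ₁ := by nlinarith
    have hlY : ℓ₁ ≤ 2 * Y * ℓ₁ := by nlinarith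
    have hSD : (nS : ℝ) * nD ≤ Y := by
      calc (nS : ℝ) * nD = 1 * nS * nD := by ring
        _ ≤ Y := by rw [hY]; gcongr
    have hSA : (nS : ℝ) * nA ≤ Y := by
      calc (nS : ℝ) * nA = nA * nS * 1 := by ring
        _ ≤ Y := by rw [hY]; gcongr; linarith
    have t₁ : L ^ 2 * (nS * nD) ≤ L * √(Y * T * ℓ₁) :=
      (mul_le_mul_of_nonneg_left (hSD.trans hYl) (by positivity)).trans hbase
    have t₂ : L ^ 2 * (nS * nA) ≤ L * √(Y * T * ℓ₁) :=
      (mul_le_mul_of_nonneg_left (hSA.trans hYl) (by positivity)).trans hbase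
    have t₃ : L ^ 2 * Real.log (δ / 2)⁻¹ ≤ L * √(Y * T * ℓ₁) :=
      (mul_le_mul_of_nonneg_left (h2δ.trans hlY) (by positivity)).trans hbase
    have t₄ : L * (√C₁ * √(nS * nD * T)) ≤ L * (5 * √(Y * T * ℓ₁)) :=
      mul_le_mul_of_nonneg_left (sqrt_mul_sqrt_le_five_mul (by positivity) (by positivity) hC₁
        (by rw [hY]; ring)) (by linarith)
    have t₅ : L * (√C₂ * √(nS * nA * T)) ≤ L * (5 * (nS * √(nA * T * ℓ₂))) := by
      refine mul_le_mul_of_nonneg_left ?_ (by linarith)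
      refine (sqrt_mul_sqrt_le_five_mul (by positivity) (by positivity) (hC₂ hT2)
        (z := nS ^ 2 * (nA * T * ℓ₂)) (by ring)).trans_eq ?_
      rw [Real.sqrt_mul (by positivity), Real.sqrt_sq (by positivity)]
    -- The lower-order terms `t₁`, `t₂`, `t₃` enter with coefficient 8 each and the roots with `2 *
    -- 2 * 3 * 5 = 60` each: in total 84 for the first root and 60 for the second.
    linarith

/-- The regret bound is sublinear in the number of steps. -/
theorem regretBound_isLittleO (ρ₁ ρ₂ : ℝ) (nS nA nD L : ℕ) {δ : ℝ} (hδ : 0 < δ) :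
    (fun K : ℕ => regretBound ρ₁ ρ₂ nS nA nD L ((K : ℝ) * (L : ℝ)) δ) =o[Filter.atTop]
      (fun K : ℕ => (K : ℝ) * (L : ℝ)) := by
  rcases Nat.eq_zero_or_pos L with rfl | hL
  · simp [regretBound]
  have hT : Filter.Tendsto (fun K : ℕ => (K : ℝ) * (L : ℝ)) Filter.atTop Filter.atTop :=
    tendsto_natCast_atTop_atTop.atTop_mul_const (by exact_mod_cast hL)
  suffices h : (fun T : ℝ => regretBound ρ₁ ρ₂ nS nA nD L T δ) =o[Filter.atTop] fun T => T from
    h.comp_tendsto hT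
  have hlog : ∀ b : ℝ, 0 ≤ b →
      (fun T : ℝ => Real.log (b * T / δ)) =o[Filter.atTop] fun T => T := by
    intro b hb
    rcases hb.eq_or_lt with rfl | hb
    · simp
    have h1 : (fun T : ℝ => Real.log (b / δ) + Real.log T) =o[Filter.atTop] fun T => T :=
      (Asymptotics.isLittleO_const_id_atTop _).add Real.isLittleO_log_id_atTop
    refine h1.congr' ?_ Filter.EventuallyEq.rfl
    filter_upwards [Filter.eventually_gt_atTop 0] with T hT
    rw [← Real.log_mul (by positivity) hT.ne']
    congr 1
    ring
  have hsqrt : ∀ a b : ℝ, 0 ≤ b →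
      (fun T : ℝ => √(a * T * Real.log (b * T / δ))) =o[Filter.atTop] fun T => T := by
    intro a b hb
    rw [Asymptotics.isLittleO_iff]
    intro ε hε
    -- The constant `ε ^ 2` becomes `ε` after multiplication by `T` and taking the root.
    have h1 := ((hlog b hb).const_mul_left a).bound (pow_pos hε 2)
    filter_upwards [h1, Filter.eventually_gt_atTop 0] with T h hT
    rw [Real.norm_of_nonneg (Real.sqrt_nonneg _), Real.norm_of_nonneg hT.le]
    rw [Real.norm_of_nonneg hT.le] at h
    refine Real.sqrt_le_iff.2 ⟨by positivity, ?_⟩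
    have h2 := mul_le_mul_of_nonneg_left ((Real.le_norm_self _).trans h) hT.le
    linarith
  have e := ((hsqrt (nA * nS * nD) (nS * nD) (by positivity)).const_mul_left (ρ₁ * L)).add
    ((hsqrt nA (nS * nA) (by positivity)).const_mul_left (ρ₂ * L * nS))
  exact e

end Numeric

/-! ### Assembly of the regret bound. -/

section Regret

variable {S : Type u} {A : Type v} {D : Type w} [Fintype S] [Fintype A] [Fintype D]
variable [DecidableEq S] [DecidableEq A] [DecidableEq D]
variable {L : ℕ} {c : Costs S A D} {M : Dynamics S A D} {δ : ℝ}
  {alg : ∀ j, History S A D L j → Policy S D L}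

/-- The sum of the truncated confidence radii along a trajectory, for the counts of the data `h`. -/
def bonusSum (C₁ C₂ : ℝ) {j : ℕ} (h : History S A D L j) (τ : Traj S A D L) : ℝ :=
  ∑ t, (bonus C₁ (cntSD h (τ t).1 (τ t).2.1) + bonus C₂ (cntSA h (τ t).1 (τ t).2.2.1))

theorem bonusSum_mem_Icc (C₁ C₂ : ℝ) {j : ℕ} (h : History S A D L j) (τ : Traj S A D L) :
    0 ≤ bonusSum C₁ C₂ h τ ∧ bonusSum C₁ C₂ h τ ≤ 2 * L := by
  refine ⟨Finset.sum_nonneg fun t _ => add_nonneg (bonus_nonneg _ _) (bonus_nonneg _ _), ?_⟩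
  calc bonusSum C₁ C₂ h τ ≤ ∑ _t : Fin L, (1 + 1 : ℝ) :=
        Finset.sum_le_sum fun t _ => add_le_add (bonus_le_one _ _) (bonus_le_one _ _)
    _ = 2 * L := by rw [Finset.sum_const, Finset.card_univ, Fintype.card_fin, nsmul_eq_mul]; ring

theorem sum_bonusSum_le (C₁ C₂ : ℝ) {K : ℕ} (h : History S A D L K) :
    ∑ k : Fin K, bonusSum C₁ C₂ (before h k) (h k).2 ≤
      (2 * L * (Fintype.card S * Fintype.card D) +
        3 * (√C₁ * √(Fintype.card S * Fintype.card D * (K * L)))) +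
      (2 * L * (Fintype.card S * Fintype.card A) +
        3 * (√C₂ * √(Fintype.card S * Fintype.card A * (K * L)))) := by
  have h₁ := sum_sum_bonus_le (fun x : Step S A D => (x.1, x.2.1)) C₁ h
  have h₂ := sum_sum_bonus_le (fun x : Step S A D => (x.1, x.2.2.1)) C₂ h
  simp only [cnt, Prod.mk.injEq, Fintype.card_prod, Nat.cast_mul] at h₁ h₂
  simp only [bonusSum, Finset.sum_add_distrib, cntSD, cntSA]
  exact add_le_add h₁ h₂

theorem expCost_sub_optCost_le_card
    (hc : ∀ s a d d', 0 ≤ c.env s a + c.ctrl d + c.switch d d' ∧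
      c.env s a + c.ctrl d + c.switch d d' ≤ 1) (π : Policy S D L) (s : S) (d : D) :
    expCost c M π s d - optCost c M L s d ≤ L := by
  linarith [(expCost_mem_Icc c M hc π s d).2, optCost_nonneg c M hc L s d]

/-- The regret of an episode, if the confidence sets contain the true laws. -/
theorem expCost_sub_optCost_le_bonusSum
    (hc : ∀ s a d d', 0 ≤ c.env s a + c.ctrl d + c.switch d d' ∧
      c.env s a + c.ctrl d + c.switch d d' ≤ 1)
    (halg : IsUCRL2MC c δ alg) (hδ : 0 < δ) {K j : ℕ} (hj : j ≤ K) (hL : 1 ≤ L) {C₁ C₂ : ℝ}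
    (hS : 1 ≤ Fintype.card S) (hA : 1 ≤ Fintype.card A) (hD : 1 ≤ Fintype.card D)
    (hC₁ : C₁ = 2 * Real.log ((K : ℝ) ^ 7 * (L : ℝ) ^ 7 * (Fintype.card S : ℝ) *
      (Fintype.card D : ℝ) * 2 ^ (Fintype.card A + 1) / δ))
    (hC₂ : C₂ = 2 * Real.log ((K : ℝ) ^ 7 * (L : ℝ) ^ 7 * (Fintype.card S : ℝ) *
      (Fintype.card A : ℝ) * 2 ^ (Fintype.card S + 1) / δ))
    (h1C₁ : 1 ≤ C₁) (h1C₂ : 1 ≤ C₂) (h : History S A D L j)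
    (hM : 2 ≤ j * L → IsPlausible M δ h) (s : S) (d : D) :
    expCost c M (alg j h) s d - optCost c M L s d ≤
      2 * L * ev (rollout M (alg j h) s d) (bonusSum C₁ C₂ h) := by
  have hL' : (1 : ℝ) ≤ L := by exact_mod_cast hL
  -- With at most one step of data all bonuses equal one, so the trivial bound `L` is enough. This
  -- covers the arbitrary first policy and the one case excluded from the confidence event.
  rcases lt_or_ge (j * L) 2 with hsmall | hlarge
  · refine (expCost_sub_optCost_le_card hc _ s d).trans ?_
    have h1 : (2 * L : ℝ) ≤ ev (rollout M (alg j h) s d) (bonusSum C₁ C₂ h) := by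
      refine le_ev _ fun τ => le_of_eq ?_
      have hb₁ : ∀ s d, bonus C₁ (cntSD h s d) = 1 := fun s d =>
        bonus_eq_one h1C₁ ((cnt_le (fun x => x.1 = s ∧ x.2.1 = d) h).trans (by omega))
      have hb₂ : ∀ s a, bonus C₂ (cntSA h s a) = 1 := fun s a =>
        bonus_eq_one h1C₂ ((cnt_le (fun x => x.1 = s ∧ x.2.2.1 = a) h).trans (by omega))
      simp only [bonusSum, hb₁, hb₂]
      rw [Finset.sum_const, Finset.card_univ, Fintype.card_fin, nsmul_eq_mul]
      ring
    nlinarith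
  · have hj1 : 1 ≤ j := Nat.pos_of_ne_zero (by rintro rfl; simp at hlarge)
    have hj' : (j : ℝ) ≤ K := by exact_mod_cast hj
    have hj1' : (0 : ℝ) < j := by exact_mod_cast hj1
    have hS' : (0 : ℝ) < Fintype.card S := by exact_mod_cast hS
    have hA' : (0 : ℝ) < Fintype.card A := by exact_mod_cast hA
    have hD' : (0 : ℝ) < Fintype.card D := by exact_mod_cast hD
    -- Replacing `j` by `K` in the logarithms enlarges the radii and gives constants common to all
    -- episodes.
    refine expCost_sub_optCost_le hc (hM hlarge) (bD := fun s d => bonus C₁ (cntSD h s d))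
      (bT := fun s a => bonus C₂ (cntSA h s a)) (fun s d => ?_) (fun s a => ?_) _
      (halg j hj1 h) s d
    · refine min_one_sqrt_le_bonus ?_ _
      rw [hC₁]
      gcongr
    · refine min_one_sqrt_le_bonus ?_ _
      rw [hC₂]
      gcongr

theorem regret_eq_zero_of_subsingleton [Subsingleton D] {K : ℕ} (h : History S A D L K) :
    regret c M alg h = 0 := by
  refine Finset.sum_eq_zero fun k _ => sub_eq_zero.2 ?_
  have : Unique (Policy S D L) := ⟨⟨alg k (before h k)⟩, fun _ => Subsingleton.elim _ _⟩
  rw [optCost, ciInf_unique]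
  exact congrArg (fun π => expCost c M π _ _) (Subsingleton.elim _ _)

theorem regretBound_nonneg {ρ₁ ρ₂ : ℝ} (h₁ : 0 ≤ ρ₁) (h₂ : 0 ≤ ρ₂) (nS nA nD L : ℕ) (T δ : ℝ) :
    0 ≤ regretBound ρ₁ ρ₂ nS nA nD L T δ := by
  unfold regretBound
  positivity

/-- The regret bound holds with high probability. -/
theorem le_toOuterMeasure_regret_le (init : ∀ j, History S A D L j → PMF (S × D))
    (hc : ∀ s a d d', 0 ≤ c.env s a + c.ctrl d + c.switch d d' ∧
      c.env s a + c.ctrl d + c.switch d d' ≤ 1)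
    (hδ : 0 < δ) (hδ1 : δ < 1) (halg : IsUCRL2MC c δ alg) (K : ℕ) :
    ENNReal.ofReal (1 - δ) ≤ (interaction M init alg K).toOuterMeasure
      {h | regret c M alg h ≤ regretBound 100 60 (Fintype.card S) (Fintype.card A)
        (Fintype.card D) L ((K : ℝ) * (L : ℝ)) δ} := by
  rw [toOuterMeasure_eq_ev]
  refine ENNReal.ofReal_le_ofReal ?_
  have hregT : ∀ h : History S A D L K, regret c M alg h ≤ (K : ℝ) * L := fun h =>
    (Finset.sum_le_sum fun k _ => expCost_sub_optCost_le_card hc _ _ _).trans_eq (by simp)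
  have hcertain : (∀ h : History S A D L K, regret c M alg h ≤ 0) →
      1 - δ ≤ ev (interaction M init alg K) ({h | regret c M alg h ≤
        regretBound 100 60 (Fintype.card S) (Fintype.card A)
          (Fintype.card D) L ((K : ℝ) * (L : ℝ)) δ}.indicator 1) := by
    intro h0
    refine le_ev _ fun h => ?_
    rw [Set.indicator_of_mem, Pi.one_apply]
    · linarith
    · exact (h0 h).trans (regretBound_nonneg (by norm_num) (by norm_num) _ _ _ _ _ _)
  rcases Nat.eq_zero_or_pos (K * L) with hKL | hKL
  · have h0 : (K : ℝ) * L = 0 := by exact_mod_cast hKL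
    exact hcertain fun h => (hregT h).trans_eq h0
  -- With one agent the first logarithm can be arbitrarily close to zero, but there is only one
  -- policy. Two agents keep it at least `log 2`.
  rcases subsingleton_or_nontrivial D with hDs | hDn
  · exact hcertain fun h => (regret_eq_zero_of_subsingleton h).le
  have hK : 1 ≤ K := Nat.pos_of_mul_pos_right hKL
  have hL : 1 ≤ L := Nat.pos_of_mul_pos_left hKL
  -- States and actions exist because probability mass functions have non-empty support.
  obtain ⟨⟨s₀, d₀⟩, -⟩ := (init 0 Fin.elim0).support_nonempty
  obtain ⟨a₀, -⟩ := (M.agent d₀ s₀).support_nonempty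
  have hS : 1 ≤ Fintype.card S := Fintype.card_pos_iff.2 ⟨s₀⟩
  have hA : 1 ≤ Fintype.card A := Fintype.card_pos_iff.2 ⟨a₀⟩
  have hD : 2 ≤ Fintype.card D := Fintype.one_lt_card
  have hT : (1 : ℝ) ≤ (K : ℝ) * L := by exact_mod_cast hKL
  have hL' : (1 : ℝ) ≤ L := by exact_mod_cast hL
  have hS' : (1 : ℝ) ≤ Fintype.card S := by exact_mod_cast hS
  have hA' : (1 : ℝ) ≤ Fintype.card A := by exact_mod_cast hA
  have hD' : (2 : ℝ) ≤ Fintype.card D := by exact_mod_cast hD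
  obtain ⟨C₁, hC₁⟩ : ∃ C, C = 2 * Real.log ((K : ℝ) ^ 7 * (L : ℝ) ^ 7 * (Fintype.card S : ℝ) *
    (Fintype.card D : ℝ) * 2 ^ (Fintype.card A + 1) / δ) := ⟨_, rfl⟩
  obtain ⟨C₂, hC₂⟩ : ∃ C, C = 2 * Real.log ((K : ℝ) ^ 7 * (L : ℝ) ^ 7 * (Fintype.card S : ℝ) *
    (Fintype.card A : ℝ) * 2 ^ (Fintype.card S + 1) / δ) := ⟨_, rfl⟩
  have hone : ∀ a b n : ℕ, 1 ≤ a → 1 ≤ b → 1 ≤ n → 1 ≤ 2 * Real.log ((K : ℝ) ^ 7 * (L : ℝ) ^ 7 *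
      (a : ℝ) * (b : ℝ) * 2 ^ n / δ) := by
    intro a b n ha hb hn
    have ha' : (1 : ℝ) ≤ a := by exact_mod_cast ha
    have hb' : (1 : ℝ) ≤ b := by exact_mod_cast hb
    have h2 : 2 ≤ (K : ℝ) ^ 7 * (L : ℝ) ^ 7 * (a : ℝ) * (b : ℝ) * 2 ^ n / δ := by
      rw [← mul_pow, le_div_iff₀ hδ]
      calc 2 * δ ≤ 1 ^ 7 * 1 * 1 * 2 ^ 1 := by linarith
        _ ≤ ((K : ℝ) * L) ^ 7 * a * b * 2 ^ n := by gcongr; norm_num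
    have := Real.log_le_log two_pos h2
    have := Real.log_two_gt_d9
    linarith
  have h1C₁ : 1 ≤ C₁ := hC₁ ▸ hone _ _ _ hS (by omega) (by omega)
  have h1C₂ : 1 ≤ C₂ := hC₂ ▸ hone _ _ _ hS hA (by omega)
  -- Each of the two bad events receives failure probability `δ / 2`.
  have hbad₁ := ev_exists_not_isPlausible_le M init alg hδ hδ1 hS hA (by omega) K
  have hbad₂ := ev_sum_ev_gt_le M init alg (G := fun _ => bonusSum C₁ C₂) (R := 2 * L)
    (by linarith) (fun _ => bonusSum_mem_Icc C₁ C₂) (half_pos hδ) K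
  set E₁ := {h : History S A D L K | ∃ k : Fin K, 2 ≤ (k : ℕ) * L ∧
    ¬ IsPlausible M δ (before h k)} with hE₁
  set E₂ := {h : History S A D L K |
      2 * ∑ k : Fin K, bonusSum C₁ C₂ (before h k) (h k).2 + 2 * (2 * L) * Real.log (δ / 2)⁻¹ <
        ∑ k : Fin K, ev (rollout M (alg k (before h k)) (h k).1.1 (h k).1.2)
          (bonusSum C₁ C₂ (before h k))} with hE₂
  have hpt : ∀ h : History S A D L K,
      1 - (E₁.indicator (1 : History S A D L K → ℝ) h + E₂.indicator 1 h) ≤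
      {h | regret c M alg h ≤ regretBound 100 60 (Fintype.card S) (Fintype.card A)
        (Fintype.card D) L ((K : ℝ) * (L : ℝ)) δ}.indicator (1 : History S A D L K → ℝ) h := by
    intro h
    have hi : ∀ E : Set (History S A D L K), 0 ≤ E.indicator (1 : History S A D L K → ℝ) h :=
      fun E => Set.indicator_nonneg (by simp) h
    by_cases hh₁ : h ∈ E₁
    · have := hi E₂
      rw [Set.indicator_of_mem hh₁, Pi.one_apply]
      exact le_trans (by linarith) (hi _)
    by_cases hh₂ : h ∈ E₂
    · have := hi E₁
      rw [Set.indicator_of_mem hh₂, Pi.one_apply]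
      exact le_trans (by linarith) (hi _)
    rw [Set.indicator_of_notMem hh₁, Set.indicator_of_notMem hh₂, Set.indicator_of_mem]
    · simp
    have hplaus : ∀ k : Fin K, 2 ≤ (k : ℕ) * L → IsPlausible M δ (before h k) := fun k hk => by
      by_contra hn
      exact hh₁ ⟨k, hk, hn⟩
    rw [hE₂, Set.mem_ofPred_eq, not_lt] at hh₂
    have hreg : regret c M alg h ≤ 2 * L * ∑ k : Fin K,
        ev (rollout M (alg k (before h k)) (h k).1.1 (h k).1.2)
          (bonusSum C₁ C₂ (before h k)) := by
      rw [Finset.mul_sum]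
      exact Finset.sum_le_sum fun k _ => expCost_sub_optCost_le_bonusSum hc halg hδ k.2.le hL hS hA
        (by omega) hC₁ hC₂ h1C₁ h1C₂ (before h k) (hplaus k) _ _
    have hb := sum_bonusSum_le C₁ C₂ h
    refine le_regretBound (C₁ := C₁) (C₂ := C₂) rfl hL' hS hA hD hT hδ hδ1 (hregT h) ?_ ?_ ?_
    · rw [hC₁, ← mul_pow, mul_assoc _ (Fintype.card S : ℝ) (Fintype.card D : ℝ)]
      refine two_mul_log_confidence_le hT (by nlinarith) hA hδ hδ1 ?_
      calc (2 : ℝ) = 1 * 2 * 1 := by norm_num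
        _ ≤ _ := by gcongr
    · intro hT2
      rw [hC₂, ← mul_pow, mul_assoc _ (Fintype.card S : ℝ) (Fintype.card A : ℝ)]
      refine two_mul_log_confidence_le hT (by nlinarith) hS hδ hδ1 ?_
      calc (2 : ℝ) = 1 * 1 * 2 := by norm_num
        _ ≤ _ := by gcongr
    · refine hreg.trans (mul_le_mul_of_nonneg_left ?_ (by linarith))
      linarith
  have hev := ev_mono (interaction M init alg K) hpt
  rw [ev_sub, ev_const, ev_add] at hev
  linarith

end Regret

end

end SwitchMDP

theorem theorem2 :
    ∃ ρ₁ ρ₂ : ℝ, 0 < ρ₁ ∧ 0 < ρ₂ ∧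
      ∀ (S : Type u) (A : Type v) (D : Type w) [Fintype S] [Fintype A] [Fintype D]
        [DecidableEq S] [DecidableEq A] [DecidableEq D]
        (c : SwitchMDP.Costs S A D) (M : SwitchMDP.Dynamics S A D) (L : ℕ) (δ : ℝ)
        (init : ∀ j, SwitchMDP.History S A D L j → PMF (S × D))
        (alg : ∀ j, SwitchMDP.History S A D L j → SwitchMDP.Policy S D L),
        (∀ s a d d', 0 ≤ c.env s a + c.ctrl d + c.switch d d' ∧
          c.env s a + c.ctrl d + c.switch d d' ≤ 1) →
        0 < δ → δ < 1 →
        SwitchMDP.IsUCRL2MC c δ alg →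
        (∀ K : ℕ,
          ENNReal.ofReal (1 - δ) ≤
            (SwitchMDP.interaction M init alg K).toOuterMeasure
              {h | SwitchMDP.regret c M alg h ≤
                SwitchMDP.regretBound ρ₁ ρ₂ (Fintype.card S) (Fintype.card A) (Fintype.card D) L
                  ((K : ℝ) * (L : ℝ)) δ}) ∧
        (fun K : ℕ => SwitchMDP.regretBound ρ₁ ρ₂ (Fintype.card S) (Fintype.card A)
            (Fintype.card D) L ((K : ℝ) * (L : ℝ)) δ) =o[Filter.atTop]
          (fun K : ℕ => (K : ℝ) * (L : ℝ)) := by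
  refine ⟨100, 60, by norm_num, by norm_num, ?_⟩
  intro S A D _ _ _ _ _ _ c M L δ init alg hc hδ hδ1 halg
  exact ⟨SwitchMDP.le_toOuterMeasure_regret_le init hc hδ hδ1 halg,
    SwitchMDP.regretBound_isLittleO 100 60 _ _ _ L hδ⟩
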